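/- Let $T$ be the infinite binary rooted tree, with vertices the finite words over $\{0,1\}$. Let $\mathrm{St}(m)\le\mathrm{Aut}\,T$ be the pointwise stabilizer of the $m$-th level, so that $[\mathrm{Aut}\,T:\mathrm{St}(m)]=2^{2^m-1}$, and equip $\mathrm{Aut}\,T$ with the metric $d(g,h)=\inf\{[\mathrm{Aut}\,T:\mathrm{St}(m)]^{-1} : g^{-1}h\in \mathrm{St}(m)\}$. The Hausdorff dimension $\dim_H G$ of a subgroup $G\le\mathrm{Aut}\,T$ is the Hausdorff dimension of its closure in this metric space. Let $B=(\mathbb Z/2\mathbb Z)^2$, and let $\omega=\omega_1\omega_2\omega_3\dots$ be an infinite sequence of non-zero elements of the dual space $B^*$. Let $a\in\mathrm{Aut}\,T$ exchange the two maximal subtrees, and let $b\in B$ act on $T$ by the recursion $b=\langle a^{\omega_1(b)},\,b@1\rangle$, $b@1^k=\langle a^{\omega_{k+1}(b)},\,b@1^{k+1}\rangle$ for $k\ge 1$, where $\langle g_0,g_1\rangle$ is the automorphism that fixes the first level and acts as $g_0$ and $g_1$ on the subtrees at the vertices $0$ and $1$. The spinal group $G_\omega$ is the subgroup of $\mathrm{Aut}\,T$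 generated by $a$ and the images of all $b\in B$. Then there is such a sequence $\omega$, with $\liminf_{k\to\infty}\dim\operatorname{span}\{\omega_i : i>k\}=2$, for which $G_\omega$ is generated by three elements and its Hausdorff dimension, which equals $$\dim_H G_\omega=\liminf_{m\to\infty}\frac{\log\bigl|G_\omega/(G_\omega\cap\mathrm{St}(m))\bigr|}{\log\bigl|\mathrm{Aut}\,T/\mathrm{St}(m)\bigr|},$$ is a transcendental real number. -/

import Mathlib

open scoped ENNReal

/-- The automorphism group of the infinite binary rooted tree. The vertices are the finite words
over `{0, 1} = {false, true}`, the root is the empty word, the word `u` is an ancestor of `v` iff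
`u` is a prefix of `v`, and an automorphism is a permutation of the vertices that preserves the
levels and the ancestor relation. -/
def treeAut : Subgroup (Equiv.Perm (List Bool)) where
  carrier := {g | (∀ w, (g w).length = w.length) ∧ ∀ u v, g u <+: g v ↔ u <+: v}
  one_mem' := ⟨fun _ => rfl, fun _ _ => Iff.rfl⟩
  mul_mem' := by
    rintro g h ⟨hg, hg'⟩ ⟨hh, hh'⟩
    exact ⟨fun w => (hg (h w)).trans (hh w), fun u v => (hg' (h u) (h v)).trans (hh' u v)⟩
  inv_mem' := by
    rintro g ⟨hg, hg'⟩
    refine ⟨fun w => ?_, fun u v => ?_⟩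
    · simpa using (hg (g⁻¹ w)).symm
    · simpa using (hg' (g⁻¹ u) (g⁻¹ v)).symm

/-- `Aut T` as a type. -/
abbrev AutT : Type := ↥treeAut

/-- The fixator in `Aut T` of the `m`-th level of the tree. -/
def levelStab (m : ℕ) : Subgroup AutT where
  carrier := {g | ∀ w : List Bool, w.length = m → g.1 w = w}
  one_mem' := fun _ _ => rfl
  mul_mem' := by
    intro g h hg hh w hw
    change g.1 (h.1 w) = w
    rw [hh w hw, hg w hw]
  inv_mem' := by
    intro g hg w hw
    change g.1⁻¹ w = w
    rw [Equiv.Perm.inv_eq_iff_eq, hg w hw]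

theorem levelStab_anti {m n : ℕ} (h : m ≤ n) : levelStab n ≤ levelStab m := by
  intro g hg w hw
  have key := hg (w ++ List.replicate (n - m) false) (by simp [hw, h])
  have hp : g.1 w <+: g.1 (w ++ List.replicate (n - m) false) :=
    (g.2.2 _ _).2 (List.prefix_append _ _)
  rw [key] at hp
  exact (List.prefix_of_prefix_length_le hp (List.prefix_append _ _)
    (g.2.1 w).le).eq_of_length (g.2.1 w)

/-- The distance between `g` and `h` in `Aut T` is the infimum of `1 / [Aut T : St(n)]` over all
`n` such that `g` and `h` agree on level `n`, where `[Aut T : St(n)] = 2 ^ (2 ^ n - 1)`. -/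
noncomputable def treeEDist (g h : AutT) : ℝ≥0∞ :=
  ⨅ n : ℕ, ⨅ _ : g⁻¹ * h ∈ levelStab n, (2 : ℝ≥0∞)⁻¹ ^ (2 ^ n - 1)

theorem treeEDist_self (g : AutT) : treeEDist g g = 0 := by
  have hle : ∀ n : ℕ, treeEDist g g ≤ (2 : ℝ≥0∞)⁻¹ ^ n := by
    intro n
    refine (iInf₂_le n (by simp)).trans ?_
    exact pow_le_pow_right_of_le_one' (by simp) (Nat.le_sub_one_of_lt Nat.lt_two_pow_self)
  have ht := ENNReal.tendsto_pow_atTop_nhds_zero_of_lt_one (r := (2 : ℝ≥0∞)⁻¹) (by norm_num)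
  exact le_antisymm (ge_of_tendsto' ht hle) zero_le

theorem treeEDist_comm (g h : AutT) : treeEDist g h = treeEDist h g := by
  have : ∀ n, g⁻¹ * h ∈ levelStab n ↔ h⁻¹ * g ∈ levelStab n := by
    intro n
    rw [← inv_mem_iff, mul_inv_rev, inv_inv]
  simp only [treeEDist, this]

theorem treeEDist_triangle (g h k : AutT) :
    treeEDist g k ≤ treeEDist g h + treeEDist h k := by
  simp only [treeEDist, ENNReal.iInf_add, ENNReal.add_iInf]
  refine le_iInf₂ fun n hn => le_iInf₂ fun m hm => ?_
  rcases le_total m n with hmn | hmn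
  · have : g⁻¹ * k ∈ levelStab m := by
      rw [show g⁻¹ * k = g⁻¹ * h * (h⁻¹ * k) by group]
      exact mul_mem hm (levelStab_anti hmn hn)
    exact (iInf₂_le m this).trans le_self_add
  · have : g⁻¹ * k ∈ levelStab n := by
      rw [show g⁻¹ * k = g⁻¹ * h * (h⁻¹ * k) by group]
      exact mul_mem (levelStab_anti hmn hm) hn
    exact (iInf₂_le n this).trans le_add_self

theorem eq_of_treeEDist_eq_zero {g h : AutT} (hgh : treeEDist g h = 0) : g = h := by
  have hmem : ∀ N, g⁻¹ * h ∈ levelStab N := by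
    intro N
    by_contra hN
    have hle : (2 : ℝ≥0∞)⁻¹ ^ (2 ^ N - 1) ≤ treeEDist g h := by
      refine le_iInf₂ fun n hn => ?_
      have hnN : n ≤ N := le_of_not_ge fun hNn => hN (levelStab_anti hNn hn)
      exact pow_le_pow_right_of_le_one' (by simp)
        (Nat.sub_le_sub_right (Nat.pow_le_pow_right (by norm_num) hnN) 1)
    rw [hgh] at hle
    exact (pow_ne_zero _ (by simp)) (le_antisymm hle zero_le)
  rw [← inv_mul_eq_one]
  exact Subtype.ext (Equiv.ext fun w => hmem w.length w rfl)

/-- `Aut T` as a metric space. The closed balls of positive radius are the cosets of the level stabilizers, and a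
coset of `St(n)` has diameter `1 / [Aut T : St(n)]`. -/
noncomputable instance : EMetricSpace AutT where
  edist := treeEDist
  edist_self := treeEDist_self
  edist_comm := treeEDist_comm
  edist_triangle := treeEDist_triangle
  eq_of_edist_eq_zero := eq_of_treeEDist_eq_zero

/-- The Hausdorff dimension of a group acting on the binary tree: the Hausdorff dimension, in the
metric space `Aut T`, of its closure. -/
noncomputable def hausdorffDim (G : Subgroup AutT) : ℝ≥0∞ :=
  dimH (closure (G : Set AutT))

/-- The order of the group `G mod m = G / Stab_G(m)`. -/
noncomputable def cardMod (G : Subgroup AutT) (m : ℕ) : ℕ :=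
  Nat.card (G ⧸ (levelStab m).subgroupOf G)

/-- The number `liminf (log |G mod m| / log |Aut T mod m|)`. -/
noncomputable def liminfDim (G : Subgroup AutT) : ℝ :=
  Filter.liminf (fun m : ℕ => Real.log (cardMod G m) / Real.log (cardMod ⊤ m)) Filter.atTop

/-- The action on words of the element of `A = C₂` corresponding to `c`: if `c = 1`, it exchanges
the two maximal subtrees; if `c = 0`, it is trivial. -/
def rootFun (c : ZMod 2) : List Bool → List Bool
  | [] => []
  | x :: w => (if c = 1 then !x else x) :: w

theorem rootFun_rootFun (c : ZMod 2) (w : List Bool) : rootFun c (rootFun c w) = w := by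
  cases w with
  | nil => rfl
  | cons x w => by_cases h : c = 1 <;> simp [rootFun, h]

theorem rootFun_length (c : ZMod 2) (w : List Bool) : (rootFun c w).length = w.length := by
  cases w <;> simp [rootFun]

theorem rootFun_prefix (c : ZMod 2) {u v : List Bool} (h : u <+: v) :
    rootFun c u <+: rootFun c v := by
  obtain ⟨t, rfl⟩ := h
  cases u with
  | nil => exact List.nil_prefix
  | cons x u => exact ⟨t, by simp [rootFun]⟩

/-- An involution of the set of words that preserves length and prefixes, as an element of
`Aut T`. -/
def autOfInvolutive (f : List Bool → List Bool) (hf : Function.Involutive f)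
    (hl : ∀ w, (f w).length = w.length) (hp : ∀ {u v}, u <+: v → f u <+: f v) : AutT :=
  ⟨hf.toPerm f, hl, fun u v => ⟨fun h => by
    have h' := hp h
    change f (f u) <+: f (f v) at h'
    rwa [hf u, hf v] at h', hp⟩⟩

/-- The generator `a` of the root group, which exchanges the two maximal subtrees. -/
def rootElt : AutT :=
  autOfInvolutive (rootFun 1) (rootFun_rootFun 1) (rootFun_length 1) (rootFun_prefix 1)

/-- The level group `B = C₂ⁿ`, as a vector space over `ℤ/2ℤ`. -/
abbrev LevelGroup (n : ℕ) : Type := Fin n → ZMod 2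

/-- Infinite sequences in the dual space of `B`; the term with index `k` is `ω_{k+1}`. -/
abbrev DualSeq (n : ℕ) : Type := ℕ → Module.Dual (ZMod 2) (LevelGroup n)

/-- The shifted sequence `σ^k ω`. -/
def DualSeq.shift {n : ℕ} (k : ℕ) (ω : DualSeq n) : DualSeq n := fun i => ω (i + k)

/-- The action on words of `b ∈ B`, given recursively by `b = ⟨ω₁(b), b@1⟩`, where `b@1` is the
same element `b` acting through the shifted sequence. -/
def spineFun {n : ℕ} (b : LevelGroup n) : DualSeq n → List Bool → List Bool
  | _, [] => []
  | ω, false :: w => false :: rootFun (ω 0 b) w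
  | ω, true :: w => true :: spineFun b (ω.shift 1) w

theorem spineFun_spineFun {n : ℕ} (b : LevelGroup n) (ω : DualSeq n) (w : List Bool) :
    spineFun b ω (spineFun b ω w) = w := by
  induction w generalizing ω with
  | nil => rfl
  | cons x w ih => cases x <;> simp [spineFun, rootFun_rootFun, ih]

theorem spineFun_length {n : ℕ} (b : LevelGroup n) (ω : DualSeq n) (w : List Bool) :
    (spineFun b ω w).length = w.length := by
  induction w generalizing ω with
  | nil => rfl
  | cons x w ih => cases x <;> simp [spineFun, rootFun_length, ih]

theorem spineFun_prefix {n : ℕ} (b : LevelGroup n) (ω : DualSeq n) {u v : List Bool}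
    (h : u <+: v) : spineFun b ω u <+: spineFun b ω v := by
  induction u generalizing ω v with
  | nil => simp [spineFun]
  | cons x u ih =>
    obtain ⟨t, rfl⟩ := h
    cases x
    · simpa [spineFun] using rootFun_prefix (ω 0 b) (List.prefix_append u t)
    · simpa [spineFun] using ih (ω.shift 1) (List.prefix_append u t)

/-- The element of `Aut T` by which `b ∈ B` acts. -/
def spineElt {n : ℕ} (ω : DualSeq n) (b : LevelGroup n) : AutT :=
  autOfInvolutive (spineFun b ω) (spineFun_spineFun b ω) (spineFun_length b ω)
    (spineFun_prefix b ω)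

/-- The spinal group `G_ω`, generated by `A ∪ B`. -/
def spinalGroup {n : ℕ} (ω : DualSeq n) : Subgroup AutT :=
  Subgroup.closure ({rootElt} ∪ Set.range (spineElt ω))

/-- The dimension of the space spanned by the first `m - 1` terms of `ω`, that is, by the
functionals through which `B` acts on the first `m` levels of the tree. -/
noncomputable def dimMod {n : ℕ} (ω : DualSeq n) (m : ℕ) : ℕ :=
  Module.finrank (ZMod 2) (Submodule.span (ZMod 2) (ω '' {i | i < m - 1}))

/-- The number `liminf_k lim_m dim (σ^k ω mod m)`. The inner limit is that of a bounded
nondecreasing sequence, so it is written as a supremum. -/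
noncomputable def diminf {n : ℕ} (ω : DualSeq n) : ℕ :=
  Filter.liminf (fun k : ℕ => ⨆ m : ℕ, dimMod (ω.shift k) m) Filter.atTop

/-! Take for the functionals the two coordinates of B, so that ω is a binary word c. On finitely
many levels the group G is then generated by the root swap a and two spine involutions. If c begins
with x, then G on m+1 levels is generated by the swap, ⟨a, y⟩ and ⟨1, z⟩, where a, y, z generate the
group H of the shifted word on m levels. Let N be the normal closure of z in H. The base part of G
contains N × N. If y ∉ N, then H/N is dihedral of order 2o, generated by the images of a and y, and
the image of the base part in H/N × H/N is again dihedral of order 2o. Hence |G| = |H|²/o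
(`card_wordGroup_succ`), whereas |G| = 2|H|² if y is trivial on m levels
(`card_wordGroup_succ_of_not_visible`). The order o doubles with each letter x at the beginning of
the shifted word; once this run is over it is 4, or 2 if x is not seen again. In a word without
cubes, and away from the last visible letters, log₂|G| - 2 log₂|H| is therefore -3 if the first
letter is repeated at once and -2 otherwise.

Summing this recursion, log₂|G| / 2^m is at least 1/2 when the last two visible letters differ. When
they agree, at a repeat i whose two predecessors are not repeats, it is 7/16, up to a vanishing
term, minus 1/8 of the sum of 2^(-(i-k)) over the earlier repeats k < i (`density_of_eq`). The
repeats are put at K! and at K! - j! for 3 ≤ j < K. Seen from K!, the sum tends to the sum of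
2^(-j!) over j ≥ 3; seen from K! - j!, the preceding repeat is too far away to matter. The liminf is
therefore 7/16 - (ℓ - 5/4)/8 with ℓ the Liouville number in base 2, which is transcendental
(`liminfDim_factorialWord`, `transcendental_affine_factorialLimit`).

For every subgroup of Aut T the Hausdorff dimension equals this liminf (`hausdorffDim_toReal`):
cosets of level stabilizers give efficient covers, and Haar measure on the closure gives the lower
bound by the mass distribution principle. -/

/-! ### Wreath products with the group of order two -/

/-- The wreath product of a group with the group of order two: `sec x` is the action on the
subtree at the letter `x`, and `s` tells whether the two subtrees are exchanged. -/
@[ext] structure Wr (D : Type) where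
  /-- the sections -/
  sec : Bool → D
  /-- the root label -/
  s : Bool

namespace Wr

variable {D E : Type}

/-- The wreath product is, as a set, a product. -/
def equivProd (D : Type) : Wr D ≃ (D × D) × Bool where
  toFun g := ((g.sec false, g.sec true), g.s)
  invFun p := ⟨fun x => cond x p.1.2 p.1.1, p.2⟩
  left_inv g := by
    ext x
    · cases x <;> rfl
    · rfl
  right_inv _ := rfl

instance [Finite D] : Finite (Wr D) := Finite.of_equiv _ (equivProd D).symm

theorem card_wr : Nat.card (Wr D) = 2 * Nat.card D ^ 2 := by
  rw [Nat.card_congr (equivProd D), Nat.card_prod, Nat.card_prod]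
  simp
  ring

/-- The elements of the base group. -/
def pair (u v : D) : Wr D := ⟨fun x => cond x v u, false⟩

@[simp] theorem pair_false (u v : D) : (pair u v).sec false = u := rfl
@[simp] theorem pair_true (u v : D) : (pair u v).sec true = v := rfl
@[simp] theorem pair_s (u v : D) : (pair u v).s = false := rfl

theorem pair_injective {u v u' v' : D} (h : pair u v = pair u' v') : u = u' ∧ v = v' := by
  refine ⟨?_, ?_⟩
  · simpa using congrArg (fun g => g.sec false) h
  · simpa using congrArg (fun g => g.sec true) h

theorem eq_pair_of_s {g : Wr D} (h : g.s = false) : g = pair (g.sec false) (g.sec true) := by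
  ext x
  · cases x <;> simp
  · simpa using h

variable [Group D] [Group E]

/-- Products are compositions with the right factor acting first, so g is read at the letter to
which h sends x. -/
instance : Mul (Wr D) := ⟨fun g h => ⟨fun x => g.sec (x ^^ h.s) * h.sec x, g.s ^^ h.s⟩⟩
instance : One (Wr D) := ⟨⟨fun _ => 1, false⟩⟩
instance : Inv (Wr D) := ⟨fun g => ⟨fun x => (g.sec (x ^^ g.s))⁻¹, g.s⟩⟩

@[simp] theorem mul_sec (g h : Wr D) (x : Bool) : (g * h).sec x = g.sec (x ^^ h.s) * h.sec x := rfl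
@[simp] theorem mul_s (g h : Wr D) : (g * h).s = (g.s ^^ h.s) := rfl
@[simp] theorem one_sec (x : Bool) : (1 : Wr D).sec x = 1 := rfl
@[simp] theorem one_s : (1 : Wr D).s = false := rfl
@[simp] theorem inv_sec (g : Wr D) (x : Bool) : (g⁻¹).sec x = (g.sec (x ^^ g.s))⁻¹ := rfl
@[simp] theorem inv_s (g : Wr D) : (g⁻¹).s = g.s := rfl

instance : Group (Wr D) :=
  Group.ofLeftAxioms
    (fun g h k => by
      ext x
      · simp [mul_assoc, Bool.xor_comm h.s k.s]
      · simp)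
    (fun g => by ext x <;> simp)
    (fun g => by ext x <;> simp)

/-- The homomorphism of wreath products induced by a homomorphism. -/
def map (φ : D →* E) : Wr D →* Wr E where
  toFun g := ⟨fun x => φ (g.sec x), g.s⟩
  map_one' := by ext x <;> simp
  map_mul' g h := by ext x <;> simp

@[simp] theorem map_sec (φ : D →* E) (g : Wr D) (x : Bool) : (map φ g).sec x = φ (g.sec x) := rfl
@[simp] theorem map_s (φ : D →* E) (g : Wr D) : (map φ g).s = g.s := rfl

/-- The root label as a homomorphism. -/
def label : Wr D →* Multiplicative (ZMod 2) where
  toFun g := Multiplicative.ofAdd (cond g.s 1 0)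
  map_one' := rfl
  map_mul' g h := by
    rw [mul_s, ← ofAdd_add]
    congr 1
    cases g.s <;> cases h.s <;> rfl

/-- The product of the values of a homomorphism into a commutative group on the sections. -/
def secProd {C : Type} [CommGroup C] (φ : D →* C) : Wr D →* C where
  toFun g := φ (g.sec false) * φ (g.sec true)
  map_one' := by simp
  map_mul' g h := by
    cases hh : h.s <;> simp [hh, mul_comm, mul_left_comm]

/-- The element which exchanges the two factors. -/
def swap (D : Type) [Group D] : Wr D := ⟨fun _ => 1, true⟩

@[simp] theorem swap_sec (x : Bool) : (swap D).sec x = 1 := rfl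
@[simp] theorem swap_s : (swap D).s = true := rfl
theorem pair_mul (u v u' v' : D) : pair u v * pair u' v' = pair (u * u') (v * v') := by
  ext x
  · cases x <;> simp
  · simp

theorem pair_inv (u v : D) : (pair u v)⁻¹ = pair u⁻¹ v⁻¹ := by
  ext x
  · cases x <;> simp
  · simp

theorem pair_one : pair (1 : D) 1 = 1 := by
  ext x
  · cases x <;> simp
  · simp

theorem pair_pow (u v : D) (n : ℕ) : pair u v ^ n = pair (u ^ n) (v ^ n) := by
  induction n with
  | zero => simp [pair_one]
  | succ n ih => rw [pow_succ, ih, pair_mul, ← pow_succ, ← pow_succ]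

theorem swap_mul_swap : swap D * swap D = 1 := by
  ext x <;> simp

theorem swap_mul_pair_mul_swap (u v : D) : swap D * pair u v * swap D = pair v u := by
  ext x
  · cases x <;> simp
  · simp

theorem eq_pair_mul_swap_of_s {g : Wr D} (h : g.s = true) :
    g = pair (g.sec true) (g.sec false) * swap D := by
  ext x
  · cases x <;> simp
  · simpa using h

/-- The base group as the range of a homomorphism. -/
def pairHom (D : Type) [Group D] : D × D →* Wr D where
  toFun p := pair p.1 p.2
  map_one' := pair_one
  map_mul' _ _ := (pair_mul _ _ _ _).symm

end Wr

/-! ### Normal closures inside a subgroup -/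

/-- The subgroup generated by the conjugates of `z` by the elements of `H`. -/
def relNormalClosure {D : Type} [Group D] (H : Subgroup D) (z : D) : Subgroup D :=
  Subgroup.closure {x | ∃ h ∈ H, x = h * z * h⁻¹}

section
variable {D : Type} [Group D]

theorem conj_mem_relNormalClosure {H : Subgroup D} {z h v : D} (hh : h ∈ H)
    (hv : v ∈ relNormalClosure H z) : h * v * h⁻¹ ∈ relNormalClosure H z := by
  induction hv using Subgroup.closure_induction with
  | mem x hx =>
    obtain ⟨k, hk, rfl⟩ := hx
    exact Subgroup.subset_closure ⟨h * k, mul_mem hh hk, by group⟩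
  | one => simp
  | mul x y _ _ hx hy =>
    have : h * (x * y) * h⁻¹ = (h * x * h⁻¹) * (h * y * h⁻¹) := by group
    rw [this]
    exact mul_mem hx hy
  | inv x _ hx =>
    have : h * x⁻¹ * h⁻¹ = (h * x * h⁻¹)⁻¹ := by group
    rw [this]
    exact inv_mem hx

theorem self_mem_relNormalClosure (H : Subgroup D) (z : D) : z ∈ relNormalClosure H z :=
  Subgroup.subset_closure ⟨1, one_mem _, by simp⟩

theorem relNormalClosure_le {H N : Subgroup D} {z : D} (h : ∀ g ∈ H, g * z * g⁻¹ ∈ N) :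
    relNormalClosure H z ≤ N := by
  refine (Subgroup.closure_le _).2 ?_
  rintro _ ⟨g, hg, rfl⟩
  exact h g hg

theorem relNormalClosure_le_of_mem {H N : Subgroup D} [N.Normal] {z : D} (h : z ∈ N) :
    relNormalClosure H z ≤ N :=
  relNormalClosure_le fun g _ => Subgroup.Normal.conj_mem ‹_› z h g

/-- Wreath computations take place in the ambient group, while quotients are taken of H as a group
of its own; this links the two normal closures. -/
theorem map_subtype_normalClosure (H : Subgroup D) (z : H) :
    (Subgroup.normalClosure {z}).map H.subtype = relNormalClosure H z := by
  rw [Subgroup.normalClosure, MonoidHom.map_closure, relNormalClosure]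
  congr 1
  ext x
  simp only [Set.mem_image, Group.mem_conjugatesOfSet_iff, Set.mem_singleton_iff, exists_eq_left,
    isConj_iff, Set.mem_ofPred_eq]
  constructor
  · rintro ⟨_, ⟨h, rfl⟩, rfl⟩
    exact ⟨h, h.2, by simp⟩
  · rintro ⟨h, hh, rfl⟩
    exact ⟨_, ⟨⟨h, hh⟩, rfl⟩, by simp⟩

theorem mem_normalClosure_iff (H : Subgroup D) (z v : H) :
    v ∈ Subgroup.normalClosure {z} ↔ (v : D) ∈ relNormalClosure H z := by
  rw [← map_subtype_normalClosure]
  exact ⟨fun h => ⟨v, h, rfl⟩, fun ⟨u, hu, huv⟩ => Subtype.ext huv ▸ hu⟩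

end

/-! ### Groups generated by two involutions -/

section Dihedral
variable {Q : Type} [Group Q]

/-- Every element of a group generated by two involutions is a power of their product, possibly
times the first of them. -/
theorem exists_zpow_of_mem_closure_pair {x y g : Q} (hx : x * x = 1) (hy : y * y = 1)
    (hg : g ∈ Subgroup.closure {x, y}) : ∃ (n : ℤ) (i : Bool), g = (x * y) ^ n * cond i x 1 := by
  have hxi : x⁻¹ = x := inv_eq_of_mul_eq_one_left hx
  have hyi : y⁻¹ = y := inv_eq_of_mul_eq_one_left hy
  have hinv : (x * y)⁻¹ = y * x := by rw [mul_inv_rev, hxi, hyi]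
  have hconj : ∀ n : ℤ, x * (x * y) ^ n = (x * y) ^ (-n) * x := by
    intro n
    have : (x * (x * y) * x⁻¹) ^ n = x * (x * y) ^ n * x⁻¹ := conj_zpow
    have h2 : x * (x * y) * x⁻¹ = (x * y)⁻¹ := by rw [hinv, hxi, ← mul_assoc, hx, one_mul]
    rw [h2, inv_zpow, ← zpow_neg] at this
    rw [this, inv_mul_cancel_right]
  have hyx : y = (x * y) ^ (-1 : ℤ) * x := by
    rw [zpow_neg_one, hinv, mul_assoc, hx, mul_one]
  induction hg using Subgroup.closure_induction with
  | mem g hg =>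
    rcases hg with rfl | hg
    · exact ⟨0, true, by simp⟩
    · rw [Set.mem_singleton_iff] at hg
      exact ⟨-1, true, hg.trans hyx⟩
  | one => exact ⟨0, false, by simp⟩
  | mul g h _ _ hg hh =>
    obtain ⟨n, i, rfl⟩ := hg
    obtain ⟨k, j, rfl⟩ := hh
    cases i
    · exact ⟨n + k, j, by simp [zpow_add, mul_assoc]⟩
    · refine ⟨n - k, !j, ?_⟩
      have : (x * y) ^ n * x * ((x * y) ^ k * cond j x 1)
          = (x * y) ^ n * (x * (x * y) ^ k) * cond j x 1 := by group
      simp only [cond_true]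
      rw [this, hconj, sub_eq_add_neg, zpow_add]
      cases j <;> simp [mul_assoc, hx]
  | inv g _ hg =>
    obtain ⟨n, i, rfl⟩ := hg
    cases i
    · exact ⟨-n, false, by simp⟩
    · exact ⟨n, true, by
        rw [mul_inv_rev, cond_true, hxi, ← zpow_neg, hconj, neg_neg]⟩

/-- A group generated by two involutions is dihedral. -/
theorem card_closure_pair {x y : Q} (hx : x * x = 1) (hy : y * y = 1) (hx1 : x ≠ 1)
    (hy1 : y ≠ 1) :
    Nat.card (Subgroup.closure {x, y}) = 2 * orderOf (x * y) := by
  have hxm : x ∈ Subgroup.closure {x, y} := Subgroup.subset_closure (by simp)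
  have hym : y ∈ Subgroup.closure {x, y} := Subgroup.subset_closure (by simp)
  -- If x were a power of xy, then x and y would commute and (xy)² = 1, so x would be 1 or xy,
  -- forcing x = 1 or y = 1.
  have hnot : ∀ n : ℤ, x ≠ (x * y) ^ n := by
    intro n hn
    have hc : Commute x (x * y) := by
      rw [hn]
      conv_rhs => rw [← hn]
      exact (Commute.refl _).zpow_left n
    have hxy : y * x = x * y := by
      have := hc.eq
      rw [← mul_assoc, hx, one_mul, mul_assoc] at this
      have h2 := congrArg (fun t => x * t) this
      simp only [← mul_assoc, hx, one_mul] at h2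
      exact h2.symm
    have hsq : (x * y) ^ (2 : ℤ) = 1 := by
      rw [zpow_two, mul_assoc, ← mul_assoc y, hxy, mul_assoc, hy, mul_one, hx]
    rcases Int.even_or_odd' n with ⟨k, rfl | rfl⟩
    · rw [zpow_mul, hsq, one_zpow] at hn
      exact hx1 hn
    · rw [zpow_add, zpow_mul, hsq, one_zpow, one_mul, zpow_one] at hn
      exact hy1 (by simpa using hn)
  let f : Subgroup.zpowers (x * y) × Bool → Subgroup.closure {x, y} := fun p =>
    ⟨p.1 * cond p.2 x 1, by
      obtain ⟨⟨g, k, rfl⟩, i⟩ := p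
      refine mul_mem (zpow_mem (mul_mem hxm hym) _) ?_
      cases i
      · exact one_mem _
      · exact hxm⟩
  have hf : Function.Bijective f := by
    constructor
    · rintro ⟨⟨_, n, rfl⟩, i⟩ ⟨⟨_, k, rfl⟩, j⟩ h
      have h' : (x * y) ^ n * cond i x 1 = (x * y) ^ k * cond j x 1 := congrArg Subtype.val h
      cases i <;> cases j
      · exact Prod.ext (Subtype.ext (by simpa using h')) rfl
      · exfalso
        simp only [cond_false, cond_true, mul_one] at h'
        exact hnot (-k + n) (by rw [zpow_add, h', zpow_neg, inv_mul_cancel_left])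
      · exfalso
        simp only [cond_false, cond_true, mul_one] at h'
        exact hnot (-n + k) (by rw [zpow_add, ← h', zpow_neg, inv_mul_cancel_left])
      · exact Prod.ext (Subtype.ext (by simpa using h')) rfl
    · rintro ⟨g, hg⟩
      obtain ⟨n, i, rfl⟩ := exists_zpow_of_mem_closure_pair hx hy hg
      exact ⟨⟨⟨_, n, rfl⟩, i⟩, rfl⟩
  rw [← Nat.card_eq_of_bijective f hf, Nat.card_prod, Nat.card_zpowers]
  simp [mul_comm]

end Dihedral

/-! ### One step of the wreath recursion -/

section BaseGroup
variable {D : Type} [Group D]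

/-- The subgroup of the direct square that is the base part of the group generated by the swap
and by the elements `⟨a, y⟩` and `⟨1, z⟩`. -/
def baseSubgroup (a y z : D) : Subgroup (D × D) :=
  Subgroup.closure {(a, y), (y, a), (1, z), (z, 1)}

/-- The subgroup of the wreath product generated by the swap and by `⟨a, y⟩` and `⟨1, z⟩`. -/
def spinalStep (a y z : D) : Subgroup (Wr D) :=
  Subgroup.closure {Wr.swap D, Wr.pair a y, Wr.pair 1 z}

theorem swap_mem_spinalStep (a y z : D) : Wr.swap D ∈ spinalStep a y z :=
  Subgroup.subset_closure (by simp)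

theorem pair_mem_spinalStep (a y z : D) : Wr.pair a y ∈ spinalStep a y z :=
  Subgroup.subset_closure (by simp)

theorem pair_one_mem_spinalStep (a y z : D) : Wr.pair 1 z ∈ spinalStep a y z :=
  Subgroup.subset_closure (by simp)

theorem pair_swap_mem_spinalStep {a y z u v : D} (h : Wr.pair u v ∈ spinalStep a y z) :
    Wr.pair v u ∈ spinalStep a y z := by
  rw [← Wr.swap_mul_pair_mul_swap]
  exact mul_mem (mul_mem (swap_mem_spinalStep a y z) h) (swap_mem_spinalStep a y z)

theorem swap_mem_baseSubgroup {a y z : D} {p : D × D} (h : p ∈ baseSubgroup a y z) :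
    p.swap ∈ baseSubgroup a y z := by
  have : (baseSubgroup a y z).map (MulEquiv.prodComm : D × D ≃* D × D).toMonoidHom
      ≤ baseSubgroup a y z := by
    rw [baseSubgroup, MonoidHom.map_closure, Subgroup.closure_le]
    rintro _ ⟨p, hp, rfl⟩
    refine Subgroup.subset_closure ?_
    simp only [Set.mem_insert_iff, Set.mem_singleton_iff] at hp
    rcases hp with rfl | rfl | rfl | rfl <;> simp
  exact this ⟨p, h, rfl⟩

/-- The swap lies in the group, so the root label imposes no condition; conjugation by it exchanges
the coordinates, under which the base group is invariant. -/
theorem mem_spinalStep_iff {a y z : D} {g : Wr D} :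
    g ∈ spinalStep a y z ↔ (g.sec false, g.sec true) ∈ baseSubgroup a y z := by
  constructor
  · intro h
    induction h using Subgroup.closure_induction with
    | mem g hg =>
      simp only [Set.mem_insert_iff, Set.mem_singleton_iff] at hg
      rcases hg with rfl | rfl | rfl
      · exact one_mem _
      · exact Subgroup.subset_closure (by simp)
      · exact Subgroup.subset_closure (by simp)
    | one => exact one_mem _
    | mul g h _ _ hg hh =>
      cases hs : h.s
      · simpa [hs] using mul_mem hg hh
      · simpa [hs] using mul_mem (swap_mem_baseSubgroup hg) hh
    | inv g _ hg =>
      cases hs : g.s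
      · simpa [hs] using inv_mem hg
      · simpa [hs] using inv_mem (swap_mem_baseSubgroup hg)
  · intro h
    have key : ∀ p ∈ baseSubgroup a y z, Wr.pair p.1 p.2 ∈ spinalStep a y z := by
      intro p hp
      have : (baseSubgroup a y z).map (Wr.pairHom D) ≤ spinalStep a y z := by
        rw [baseSubgroup, MonoidHom.map_closure, Subgroup.closure_le]
        rintro _ ⟨p, hp, rfl⟩
        simp only [Set.mem_insert_iff, Set.mem_singleton_iff] at hp
        rcases hp with rfl | rfl | rfl | rfl
        · exact pair_mem_spinalStep a y z
        · exact pair_swap_mem_spinalStep (pair_mem_spinalStep a y z)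
        · exact pair_one_mem_spinalStep a y z
        · exact pair_swap_mem_spinalStep (pair_one_mem_spinalStep a y z)
      exact this ⟨p, hp, rfl⟩
    cases hs : g.s
    · rw [Wr.eq_pair_of_s hs]
      exact key _ h
    · rw [Wr.eq_pair_mul_swap_of_s hs]
      exact mul_mem (key _ (swap_mem_baseSubgroup h)) (swap_mem_spinalStep a y z)

theorem card_spinalStep (a y z : D) :
    Nat.card (spinalStep a y z) = 2 * Nat.card (baseSubgroup a y z) := by
  let e : spinalStep a y z ≃ baseSubgroup a y z × Bool :=
    { toFun := fun g => (⟨(g.1.sec false, g.1.sec true), mem_spinalStep_iff.1 g.2⟩, g.1.s)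
      invFun := fun p => ⟨⟨fun x => cond x p.1.1.2 p.1.1.1, p.2⟩, mem_spinalStep_iff.2 p.1.2⟩
      left_inv := by
        rintro ⟨g, hg⟩
        refine Subtype.ext (Wr.ext (funext fun x => ?_) rfl)
        cases x <;> rfl
      right_inv := fun p => rfl }
  rw [Nat.card_congr e, Nat.card_prod]
  simp [mul_comm]

/-- Each of a, y, z is the second coordinate of a generator, so the second projection of the base
group is onto. Conjugating (1, z) by (u, h) then yields (1, hzh⁻¹) for every h. -/
theorem exists_mem_baseSubgroup {a y z h : D} (hh : h ∈ Subgroup.closure {a, y, z}) :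
    ∃ u ∈ Subgroup.closure {a, y, z}, (u, h) ∈ baseSubgroup a y z := by
  induction hh using Subgroup.closure_induction with
  | mem h hh =>
    simp only [Set.mem_insert_iff, Set.mem_singleton_iff] at hh
    rcases hh with rfl | rfl | rfl
    · exact ⟨y, Subgroup.subset_closure (by simp), Subgroup.subset_closure (by simp)⟩
    · exact ⟨a, Subgroup.subset_closure (by simp), Subgroup.subset_closure (by simp)⟩
    · exact ⟨1, one_mem _, Subgroup.subset_closure (by simp)⟩
  | one => exact ⟨1, one_mem _, one_mem _⟩
  | mul g h _ _ hg hh =>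
    obtain ⟨u, hu, hu'⟩ := hg
    obtain ⟨v, hv, hv'⟩ := hh
    exact ⟨u * v, mul_mem hu hv, by simpa using mul_mem hu' hv'⟩
  | inv g _ hg =>
    obtain ⟨u, hu, hu'⟩ := hg
    exact ⟨u⁻¹, inv_mem hu, by simpa using inv_mem hu'⟩

theorem baseSubgroup_le (a y z : D) :
    baseSubgroup a y z ≤ (Subgroup.closure {a, y, z}).prod (Subgroup.closure {a, y, z}) := by
  refine (Subgroup.closure_le _).2 ?_
  have ha : a ∈ Subgroup.closure {a, y, z} := Subgroup.subset_closure (by simp)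
  have hy : y ∈ Subgroup.closure {a, y, z} := Subgroup.subset_closure (by simp)
  have hz : z ∈ Subgroup.closure {a, y, z} := Subgroup.subset_closure (by simp)
  rintro p hp
  simp only [Set.mem_insert_iff, Set.mem_singleton_iff] at hp
  rcases hp with rfl | rfl | rfl | rfl <;> simp [Subgroup.mem_prod, ha, hy, hz]

/-- The normal closure of `⟨1, z⟩` contains `⟨1, v⟩` for all `v` in the normal closure of `z`. -/
theorem pair_one_mem_relNormalClosure {a y z v : D}
    (hv : v ∈ relNormalClosure (Subgroup.closure {a, y, z}) z) :
    Wr.pair 1 v ∈ relNormalClosure (spinalStep a y z) (Wr.pair 1 z) := by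
  induction hv using Subgroup.closure_induction with
  | mem x hx =>
    obtain ⟨h, hh, rfl⟩ := hx
    obtain ⟨u, -, hu⟩ := exists_mem_baseSubgroup hh
    have hm : Wr.pair u h ∈ spinalStep a y z := mem_spinalStep_iff.2 hu
    have := conj_mem_relNormalClosure hm (self_mem_relNormalClosure _ (Wr.pair 1 z))
    simpa [Wr.pair_mul, Wr.pair_inv] using this
  | one => simp [Wr.pair_one]
  | mul x y _ _ hx hy => simpa [Wr.pair_mul] using mul_mem hx hy
  | inv x _ hx => simpa [Wr.pair_inv] using inv_mem hx

/-- Conjugating ⟨1, z⟩ by an element that fixes the first level stays in 1 × N, and by any other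
element lands in N × 1, where N is the normal closure of z. Hence the normal closure is exactly N ×
N. -/
theorem pair_mem_relNormalClosure_iff {a y z u v : D} :
    Wr.pair u v ∈ relNormalClosure (spinalStep a y z) (Wr.pair 1 z) ↔
      u ∈ relNormalClosure (Subgroup.closure {a, y, z}) z ∧
        v ∈ relNormalClosure (Subgroup.closure {a, y, z}) z := by
  set H := Subgroup.closure {a, y, z} with hH
  constructor
  · intro h
    have hle : relNormalClosure (spinalStep a y z) (Wr.pair 1 z) ≤
        ((relNormalClosure H z).prod (relNormalClosure H z)).map (Wr.pairHom D) := by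
      refine relNormalClosure_le fun g hg => ?_
      have hg' := baseSubgroup_le a y z (mem_spinalStep_iff.1 hg)
      rw [← hH] at hg'
      have hz := self_mem_relNormalClosure H z
      cases hs : g.s
      · rw [Wr.eq_pair_of_s hs]
        exact ⟨(1, g.sec true * z * (g.sec true)⁻¹),
          Subgroup.mem_prod.2 ⟨one_mem _, conj_mem_relNormalClosure hg'.2 hz⟩, by
            simp [Wr.pairHom, Wr.pair_mul, Wr.pair_inv]⟩
      · refine ⟨(g.sec true * z * (g.sec true)⁻¹, 1),
          Subgroup.mem_prod.2 ⟨conj_mem_relNormalClosure hg'.2 hz, one_mem _⟩, ?_⟩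
        ext x
        · cases x <;> simp [Wr.pairHom, hs]
        · simp [Wr.pairHom, hs]
    obtain ⟨p, hp, hpe⟩ := hle h
    obtain ⟨rfl, rfl⟩ := Wr.pair_injective hpe
    exact hp
  · rintro ⟨hu, hv⟩
    have h1 := pair_one_mem_relNormalClosure hv
    have h2 := pair_one_mem_relNormalClosure hu
    have h3 := conj_mem_relNormalClosure (swap_mem_spinalStep a y z) h2
    rw [inv_eq_of_mul_eq_one_left Wr.swap_mul_swap, Wr.swap_mul_pair_mul_swap] at h3
    simpa [Wr.pair_mul] using mul_mem h3 h1

theorem s_eq_false_of_mem_relNormalClosure {H : Subgroup (Wr D)} {z g : Wr D} (hz : z.s = false)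
    (hg : g ∈ relNormalClosure H z) : g.s = false := by
  have hle : relNormalClosure H z ≤ (Wr.label (D := D)).ker :=
    relNormalClosure_le_of_mem (by simp [MonoidHom.mem_ker, Wr.label, hz])
  have := hle hg
  cases hs : g.s
  · rfl
  · simp [MonoidHom.mem_ker, Wr.label, hs] at this

theorem swap_mul_pair_pow (u v : D) (n : ℕ) :
    (Wr.swap D * Wr.pair u v) ^ (2 * n) = Wr.pair ((v * u) ^ n) ((u * v) ^ n) := by
  rw [pow_mul, pow_two, ← mul_assoc, Wr.swap_mul_pair_mul_swap, Wr.pair_mul, Wr.pair_pow]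

/-- Odd powers of `swap * g` exchange the two subtrees, if `g` fixes them. -/
theorem swap_mul_pair_pow_odd (u v : D) (n : ℕ) :
    ((Wr.swap D * Wr.pair u v) ^ (2 * n + 1)).s = true := by
  rw [pow_succ, swap_mul_pair_pow]
  simp

/-- The products ya and ay are conjugate under a. -/
theorem mul_pow_mem_iff {N H : Subgroup D} (hN : ∀ h ∈ H, ∀ v ∈ N, h * v * h⁻¹ ∈ N) {a y : D}
    (ha : a ∈ H) (n : ℕ) : (y * a) ^ n ∈ N ↔ (a * y) ^ n ∈ N := by
  have key : a * (y * a) ^ n * a⁻¹ = (a * y) ^ n := by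
    rw [← conj_pow]
    congr 1
    group
  constructor
  · intro h
    rw [← key]
    exact hN a ha _ h
  · intro h
    have := hN a⁻¹ (inv_mem ha) _ h
    rwa [← key, show a⁻¹ * (a * (y * a) ^ n * a⁻¹) * a⁻¹⁻¹ = (y * a) ^ n by group] at this

/-- The order of the product of the two dihedral generators doubles at each level. -/
theorem pow_mem_relNormalClosure_spinalStep {a y z : D} {o : ℕ}
    (h : ∀ n, (a * y) ^ n ∈ relNormalClosure (Subgroup.closure {a, y, z}) z ↔ o ∣ n) (n : ℕ) :
    (Wr.swap D * Wr.pair a y) ^ n ∈ relNormalClosure (spinalStep a y z) (Wr.pair 1 z) ↔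
      2 * o ∣ n := by
  have hz : (Wr.pair 1 z : Wr D).s = false := rfl
  rcases Nat.even_or_odd' n with ⟨k, rfl | rfl⟩
  · rw [swap_mul_pair_pow, pair_mem_relNormalClosure_iff,
      mul_pow_mem_iff (H := Subgroup.closure {a, y, z})
        (fun g hg v hv => conj_mem_relNormalClosure hg hv) (Subgroup.subset_closure (by simp)),
      and_self, h, Nat.mul_dvd_mul_iff_left two_pos]
  · constructor
    · intro hm
      have := s_eq_false_of_mem_relNormalClosure hz hm
      rw [swap_mul_pair_pow_odd] at this
      exact absurd this (by simp)
    · intro hd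
      exact absurd (dvd_trans (dvd_mul_right 2 o) hd) (by omega)

end BaseGroup

/-! ### Orders of the base group and of the wreath step -/

section Count
variable {D E : Type} [Group D] [Group E]

theorem closure_pair_one_prod {Q : Type} [Group Q] {x : Q} (hx : x * x = 1) (hx1 : x ≠ 1) :
    Nat.card (Subgroup.closure {((x, 1) : Q × Q), (1, x)}) = 4 := by
  have ho : orderOf (((x, 1) : Q × Q) * (1, x)) = 2 := by
    refine orderOf_eq_prime ?_ ?_
    · simp [pow_two, hx]
    · simpa using hx1
  rw [card_closure_pair (by simp [hx]) (by simp [hx]) (by simpa using hx1) (by simpa using hx1), ho]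

theorem prod_mk_mem_baseSubgroup {a y z v : E} (htop : Subgroup.closure {a, y, z} = ⊤)
    (hv : v ∈ Subgroup.normalClosure {z}) : ((1, v) : E × E) ∈ baseSubgroup a y z := by
  induction hv using Subgroup.closure_induction with
  | mem x hx =>
    rw [Group.mem_conjugatesOfSet_iff] at hx
    obtain ⟨z', hz', hc⟩ := hx
    rw [Set.mem_singleton_iff.1 hz'] at hc
    obtain ⟨h, rfl⟩ := isConj_iff.1 hc
    obtain ⟨u, -, hu⟩ := exists_mem_baseSubgroup (a := a) (y := y) (z := z) (h := h)
      (by rw [htop]; trivial)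
    have hz : ((1, z) : E × E) ∈ baseSubgroup a y z := Subgroup.subset_closure (by simp)
    simpa using mul_mem (mul_mem hu hz) (inv_mem hu)
  | one => exact one_mem _
  | mul x y _ _ hx hy => simpa using mul_mem hx hy
  | inv x _ hx => simpa using inv_mem hx

theorem ker_le_baseSubgroup {a y z : E} (htop : Subgroup.closure {a, y, z} = ⊤) :
    ((QuotientGroup.mk' (Subgroup.normalClosure {z})).prodMap
      (QuotientGroup.mk' (Subgroup.normalClosure {z}))).ker ≤ baseSubgroup a y z := by
  rintro ⟨u, v⟩ h
  rw [MonoidHom.mem_ker] at h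
  have h' := Prod.ext_iff.1 h
  simp only [MonoidHom.prodMap_def, MonoidHom.prod_apply, MonoidHom.comp_apply,
    MonoidHom.coe_fst, MonoidHom.coe_snd, Prod.fst_one, Prod.snd_one, QuotientGroup.mk'_apply,
    QuotientGroup.eq_one_iff] at h'
  have h1 := prod_mk_mem_baseSubgroup htop h'.2
  have h2 := swap_mem_baseSubgroup (prod_mk_mem_baseSubgroup htop h'.1)
  simpa using mul_mem h2 h1

/-- The base group contains N × N, the kernel of the projection to the square of the quotient by N.
In the image the generators (1, z) and (z, 1) disappear. -/
theorem card_baseSubgroup_eq_mul [Finite E] {a y z : E} (htop : Subgroup.closure {a, y, z} = ⊤) :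
    Nat.card (baseSubgroup a y z) = Nat.card (Subgroup.normalClosure {z}) ^ 2 *
      Nat.card (Subgroup.closure
        {((QuotientGroup.mk a, QuotientGroup.mk y) :
          (E ⧸ Subgroup.normalClosure {z}) × (E ⧸ Subgroup.normalClosure {z})),
          (QuotientGroup.mk y, QuotientGroup.mk a)}) := by
  set N := Subgroup.normalClosure {z} with hN
  set f := (QuotientGroup.mk' N).prodMap (QuotientGroup.mk' N) with hf
  have hker : Nat.card f.ker = Nat.card N ^ 2 := by
    have : f.ker = N.prod N := by
      rw [hf, MonoidHom.ker_prodMap, QuotientGroup.ker_mk']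
    rw [this, Nat.card_congr (Subgroup.prodEquiv N N).toEquiv, Nat.card_prod, sq]
  have hz : (QuotientGroup.mk z : E ⧸ N) = 1 :=
    (QuotientGroup.eq_one_iff z).2 (Subgroup.subset_normalClosure rfl)
  have hmap : (baseSubgroup a y z).map f = Subgroup.closure
      {((QuotientGroup.mk a, QuotientGroup.mk y) : (E ⧸ N) × (E ⧸ N)),
        (QuotientGroup.mk y, QuotientGroup.mk a)} := by
    rw [baseSubgroup, MonoidHom.map_closure]
    refine le_antisymm ((Subgroup.closure_le _).2 ?_) (Subgroup.closure_mono ?_)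
    · rintro _ ⟨p, hp, rfl⟩
      simp only [Set.mem_insert_iff, Set.mem_singleton_iff] at hp
      rcases hp with rfl | rfl | rfl | rfl
      · exact Subgroup.subset_closure (by simp [hf])
      · exact Subgroup.subset_closure (by simp [hf])
      · rw [show f (1, z) = 1 from Prod.ext rfl hz]
        exact one_mem _
      · rw [show f (z, 1) = 1 from Prod.ext hz rfl]
        exact one_mem _
    · rintro p hp
      simp only [Set.mem_insert_iff, Set.mem_singleton_iff] at hp
      rcases hp with rfl | rfl
      · exact ⟨(a, y), by simp, rfl⟩
      · exact ⟨(y, a), by simp, rfl⟩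
  rw [← hmap, ← Subgroup.relIndex_ker, ← hker, ← Subgroup.relIndex_bot_left,
    ← Subgroup.relIndex_bot_left, Subgroup.relIndex_mul_relIndex _ _ _ bot_le
      (ker_le_baseSubgroup htop)]

theorem closure_quotient_eq_top {a y z : E} (htop : Subgroup.closure {a, y, z} = ⊤) :
    Subgroup.closure {(QuotientGroup.mk a : E ⧸ Subgroup.normalClosure {z}),
      QuotientGroup.mk y} = ⊤ := by
  set N := Subgroup.normalClosure {z} with hN
  have hz : (QuotientGroup.mk z : E ⧸ N) = 1 :=
    (QuotientGroup.eq_one_iff z).2 (Subgroup.subset_normalClosure rfl)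
  rw [eq_top_iff, ← Subgroup.map_top_of_surjective _ (QuotientGroup.mk'_surjective N), ← htop,
    MonoidHom.map_closure, Subgroup.closure_le]
  rintro _ ⟨p, hp, rfl⟩
  simp only [Set.mem_insert_iff, Set.mem_singleton_iff] at hp
  rcases hp with rfl | rfl | rfl
  · exact Subgroup.subset_closure (Or.inl rfl)
  · exact Subgroup.subset_closure (Or.inr rfl)
  · simp [hz]

/-- The order of the base group, if the quotient by the normal closure of `z` is dihedral. -/
theorem card_baseSubgroup_of_notMem [Finite E] {a y z : E}
    (htop : Subgroup.closure {a, y, z} = ⊤) (ha : a * a = 1) (hy : y * y = 1)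
    (haN : a ∉ Subgroup.normalClosure {z}) (hyN : y ∉ Subgroup.normalClosure {z}) {o : ℕ}
    (ho : ∀ n, (a * y) ^ n ∈ Subgroup.normalClosure {z} ↔ o ∣ n) :
    Nat.card (baseSubgroup a y z) * (2 * o) = Nat.card E ^ 2 := by
  have hcard := card_baseSubgroup_eq_mul htop
  have htopQ := closure_quotient_eq_top htop
  set N := Subgroup.normalClosure {z} with hN
  set α : E ⧸ N := QuotientGroup.mk a with hα
  set β : E ⧸ N := QuotientGroup.mk y with hβ
  have hα2 : α * α = 1 := by rw [hα, ← QuotientGroup.mk_mul, ha]; rfl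
  have hβ2 : β * β = 1 := by rw [hβ, ← QuotientGroup.mk_mul, hy]; rfl
  have hα1 : α ≠ 1 := fun h => haN ((QuotientGroup.eq_one_iff a).1 h)
  have hβ1 : β ≠ 1 := fun h => hyN ((QuotientGroup.eq_one_iff y).1 h)
  have hpow : ∀ n, (α * β) ^ n = 1 ↔ o ∣ n := by
    intro n
    rw [← ho, ← QuotientGroup.eq_one_iff]
    rfl
  have hord : orderOf (α * β) = o :=
    Nat.dvd_antisymm (orderOf_dvd_of_pow_eq_one ((hpow o).2 dvd_rfl))
      ((hpow _).1 (pow_orderOf_eq_one _))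
  have hpow' : ∀ n, (β * α) ^ n = 1 ↔ o ∣ n := by
    intro n
    have h : β * α = (α * β)⁻¹ := by
      rw [mul_inv_rev, inv_eq_of_mul_eq_one_left hα2, inv_eq_of_mul_eq_one_left hβ2]
    rw [h, inv_pow, inv_eq_one, hpow]
  -- The product is (αβ, βα) with βα = (αβ)⁻¹, so both coordinates have order o. Thus the image of
  -- the base group is dihedral of the same order 2o as the quotient E/N.
  have hord' : orderOf (((α, β) : (E ⧸ N) × (E ⧸ N)) * (β, α)) = o := by
    have hp : ∀ n, (((α, β) : (E ⧸ N) × (E ⧸ N)) * (β, α)) ^ n = 1 ↔ o ∣ n := by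
      intro n
      rw [Prod.mk_mul_mk, Prod.pow_mk, Prod.mk_eq_one, hpow, hpow', and_self]
    exact Nat.dvd_antisymm (orderOf_dvd_of_pow_eq_one ((hp o).2 dvd_rfl))
      ((hp _).1 (pow_orderOf_eq_one _))
  have hQ : Nat.card (E ⧸ N) = 2 * o := by
    rw [← hord, ← card_closure_pair hα2 hβ2 hα1 hβ1, htopQ, Subgroup.card_top]
  rw [card_closure_pair (by simp [hα2, hβ2]) (by simp [hα2, hβ2]) (by simp [hα1])
    (by simp [hα1]), hord'] at hcard
  rw [hcard, Subgroup.card_eq_card_quotient_mul_card_subgroup N, hQ]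
  ring

/-- The order of the base group, if `y` lies in the normal closure of `z`. -/
theorem card_baseSubgroup_of_mem [Finite E] {a y z : E}
    (htop : Subgroup.closure {a, y, z} = ⊤) (ha : a * a = 1)
    (haN : a ∉ Subgroup.normalClosure {z}) (hyN : y ∈ Subgroup.normalClosure {z}) :
    Nat.card (baseSubgroup a y z) = Nat.card E ^ 2 := by
  have hcard := card_baseSubgroup_eq_mul htop
  have htopQ := closure_quotient_eq_top htop
  set N := Subgroup.normalClosure {z} with hN
  set α : E ⧸ N := QuotientGroup.mk a with hα
  have hβ : (QuotientGroup.mk y : E ⧸ N) = 1 := (QuotientGroup.eq_one_iff y).2 hyN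
  have hα2 : α * α = 1 := by rw [hα, ← QuotientGroup.mk_mul, ha]; rfl
  have hα1 : α ≠ 1 := fun h => haN ((QuotientGroup.eq_one_iff a).1 h)
  -- With β = 1 the image is the full square of the group {1, α}, hence of order 4, and E/N has
  -- order 2: the base group is all of E × E.
  rw [hβ, closure_pair_one_prod hα2 hα1] at hcard
  rw [hβ, Set.pair_comm, Subgroup.closure_insert_one, ← Subgroup.zpowers_eq_closure] at htopQ
  have hQ : Nat.card (E ⧸ N) = 2 := by
    rw [← orderOf_eq_prime (p := 2) (by rw [pow_two, hα2]) hα1, ← Nat.card_zpowers, htopQ,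
      Subgroup.card_top]
  rw [hcard, Subgroup.card_eq_card_quotient_mul_card_subgroup N, hQ]
  ring

/-- The base group does not depend on the ambient group. -/
theorem card_baseSubgroup_map {φ : E →* D} (hφ : Function.Injective φ) (a y z : E) :
    Nat.card (baseSubgroup (φ a) (φ y) (φ z)) = Nat.card (baseSubgroup a y z) := by
  have hinj : Function.Injective (φ.prodMap φ) := fun p q h => by
    have h' := Prod.ext_iff.1 h
    exact Prod.ext (hφ h'.1) (hφ h'.2)
  rw [← Subgroup.card_map_of_injective hinj, baseSubgroup, baseSubgroup, MonoidHom.map_closure]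
  simp [Set.image_insert_eq]

theorem closure_in_subtype_eq_top {a y z : D} :
    Subgroup.closure {(⟨a, Subgroup.subset_closure (by simp)⟩ : Subgroup.closure {a, y, z}),
      ⟨y, Subgroup.subset_closure (by simp)⟩, ⟨z, Subgroup.subset_closure (by simp)⟩} = ⊤ := by
  refine Subgroup.map_injective (Subgroup.subtype_injective _) ?_
  rw [MonoidHom.map_closure, ← MonoidHom.range_eq_map, Subgroup.range_subtype]
  simp [Set.image_insert_eq]

/-- The factor 2 contributed by the swap cancels the 2 in the order 2o of the dihedral quotient. -/
theorem card_spinalStep_of_notMem [Finite D] {a y z : D} (ha : a * a = 1) (hy : y * y = 1)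
    (haN : a ∉ relNormalClosure (Subgroup.closure {a, y, z}) z)
    (hyN : y ∉ relNormalClosure (Subgroup.closure {a, y, z}) z) {o : ℕ}
    (ho : ∀ n, (a * y) ^ n ∈ relNormalClosure (Subgroup.closure {a, y, z}) z ↔ o ∣ n) :
    Nat.card (spinalStep a y z) * o = Nat.card (Subgroup.closure {a, y, z}) ^ 2 := by
  have h := card_baseSubgroup_of_notMem (closure_in_subtype_eq_top (a := a) (y := y) (z := z))
    (Subtype.ext ha) (Subtype.ext hy) (by rwa [mem_normalClosure_iff])
    (by rwa [mem_normalClosure_iff]) (o := o)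
    (fun n => by rw [mem_normalClosure_iff]; exact ho n)
  rw [← h, ← card_baseSubgroup_map (Subgroup.subtype_injective _), card_spinalStep]
  simp only [Subgroup.subtype_apply]
  ring

theorem card_spinalStep_of_mem [Finite D] {a y z : D} (ha : a * a = 1)
    (haN : a ∉ relNormalClosure (Subgroup.closure {a, y, z}) z)
    (hyN : y ∈ relNormalClosure (Subgroup.closure {a, y, z}) z) :
    Nat.card (spinalStep a y z) = 2 * Nat.card (Subgroup.closure {a, y, z}) ^ 2 := by
  have h := card_baseSubgroup_of_mem (closure_in_subtype_eq_top (a := a) (y := y) (z := z))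
    (Subtype.ext ha) (by rwa [mem_normalClosure_iff]) (by rwa [mem_normalClosure_iff])
  rw [← h, ← card_baseSubgroup_map (Subgroup.subtype_injective _), card_spinalStep]
  simp only [Subgroup.subtype_apply]

end Count

/-! ### Finite trees and spine elements -/

/-- The automorphism group of the binary tree with `m` levels below the root. -/
@[reducible] def Port : ℕ → Type
  | 0 => Unit
  | m + 1 => Wr (Port m)

/-- The group structure on the automorphisms of the finite binary tree. -/
@[reducible] instance Port.group : ∀ m, Group (Port m)
  | 0 => (inferInstance : Group Unit)
  | m + 1 => @Wr.instGroup (Port m) (Port.group m)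

instance Port.finite : ∀ m, Finite (Port m)
  | 0 => inferInstanceAs (Finite Unit)
  | m + 1 => @Wr.instFinite (Port m) (Port.finite m)

theorem Port.card (m : ℕ) : Nat.card (Port m) = 2 ^ (2 ^ m - 1) := by
  induction m with
  | zero => simp [Port]
  | succ m ih =>
    have h : Nat.card (Port (m + 1)) = 2 * Nat.card (Port m) ^ 2 := Wr.card_wr
    rw [h, ih, ← pow_mul, ← pow_succ']
    congr 1
    have := Nat.one_le_two_pow (n := m)
    rw [pow_succ]
    omega

/-- The swap of the two maximal subtrees of the finite tree. -/
def rt : ∀ m, Port m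
  | 0 => ()
  | m + 1 => Wr.swap (Port m)

/-- The element of the finite tree whose label at the level `i + 1` of the spine is nontrivial iff
the letter `c i` is `x`. -/
def sp : ∀ m, (ℕ → Bool) → Bool → Port m
  | 0, _, _ => ()
  | m + 1, c, x => Wr.pair (if c 0 = x then rt m else 1) (sp m (fun i => c (i + 1)) x)

/-- The group generated by the swap and the two spine elements. -/
def wordGroup (m : ℕ) (c : ℕ → Bool) (x : Bool) : Subgroup (Port m) :=
  Subgroup.closure {rt m, sp m c x, sp m c (!x)}

theorem wordGroup_not (m : ℕ) (c : ℕ → Bool) (x : Bool) :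
    wordGroup m c (!x) = wordGroup m c x := by
  rw [wordGroup, wordGroup, Bool.not_not, Set.pair_comm]

theorem wordGroup_eq (m : ℕ) (c : ℕ → Bool) (x y : Bool) : wordGroup m c x = wordGroup m c y := by
  cases x <;> cases y
  · rfl
  · exact (wordGroup_not m c false).symm
  · exact wordGroup_not m c false
  · rfl

theorem sp_succ_head {m : ℕ} {c : ℕ → Bool} {x : Bool} (h : c 0 = x) :
    sp (m + 1) c x = Wr.pair (rt m) (sp m (fun i => c (i + 1)) x) := by
  simp [sp, h]

theorem sp_succ_of_ne {m : ℕ} {c : ℕ → Bool} {x : Bool} (h : c 0 ≠ x) :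
    sp (m + 1) c x = Wr.pair (1 : Port m) (sp m (fun i => c (i + 1)) x) := by
  simp [sp, h]

theorem wordGroup_succ {m : ℕ} {c : ℕ → Bool} {x : Bool} (h : c 0 = x) :
    wordGroup (m + 1) c x = spinalStep (D := Port m) (rt m) (sp m (fun i => c (i + 1)) x)
      (sp m (fun i => c (i + 1)) (!x)) := by
  rw [wordGroup, sp_succ_head h, sp_succ_of_ne (by simp [h])]
  rfl

theorem rt_mul_self (m : ℕ) : rt m * rt m = 1 := by
  cases m with
  | zero => rfl
  | succ m => exact Wr.swap_mul_swap

theorem sp_mul_self (m : ℕ) (c : ℕ → Bool) (x : Bool) : sp m c x * sp m c x = 1 := by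
  induction m generalizing c with
  | zero => rfl
  | succ m ih =>
    change Wr.pair (D := Port m) _ _ * Wr.pair _ _ = 1
    rw [Wr.pair_mul, ih, ← Wr.pair_one]
    congr 1
    split_ifs
    · exact rt_mul_self m
    · exact one_mul _

/-- The letter `x` occurs among the letters of `c` that act on the first `m` levels. -/
def Visible (m : ℕ) (c : ℕ → Bool) (x : Bool) : Prop := ∃ i, i + 1 < m ∧ c i = x

theorem Visible.of_shift {m : ℕ} {c : ℕ → Bool} {x : Bool}
    (h : Visible m (fun i => c (i + 1)) x) : Visible (m + 1) c x := by
  obtain ⟨i, hi, hc⟩ := h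
  exact ⟨i + 1, by omega, hc⟩

/-- The letter c i puts a label at depth i+1, which moves only vertices from level i+2 on; hence the
bound i+1 < m in `Visible`. -/
theorem sp_eq_one {m : ℕ} {c : ℕ → Bool} {x : Bool} (h : ¬ Visible m c x) : sp m c x = 1 := by
  induction m generalizing c with
  | zero => rfl
  | succ m ih =>
    rw [sp, ih fun hv => h hv.of_shift]
    have : (if c 0 = x then rt m else 1) = (1 : Port m) := by
      split_ifs with h0
      · cases m with
        | zero => rfl
        | succ m => exact absurd ⟨0, by omega, h0⟩ h
      · rfl
    rw [this]
    exact Wr.pair_one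

/-! ### Level parities and the dihedral orders -/

/-- The sum of the labels at a level of the finite tree. -/
def parity : ∀ m, ℕ → (Port m →* Multiplicative (ZMod 2))
  | 0, _ => 1
  | m + 1, 0 => Wr.label (D := Port m)
  | m + 1, j + 1 => Wr.secProd (D := Port m) (parity m j)

theorem parity_rt (m j : ℕ) : parity m (j + 1) (rt m) = 1 := by
  cases m with
  | zero => rfl
  | succ m =>
    change parity m j 1 * parity m j 1 = 1
    simp

theorem parity_zero_sp (m : ℕ) (c : ℕ → Bool) (x : Bool) : parity m 0 (sp m c x) = 1 := by
  cases m <;> rfl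

/-- At depth j+1 the only label of a spine element that can be nontrivial is the one just off the
spine, and it is governed by the letter c j. So the parities separate the two spine elements. -/
theorem parity_sp {m j : ℕ} (h : j + 1 < m) (c : ℕ → Bool) (x : Bool) :
    parity m (j + 1) (sp m c x) = Multiplicative.ofAdd (if c j = x then 1 else 0) := by
  induction j generalizing m c with
  | zero =>
    obtain ⟨m, rfl⟩ : ∃ k, m = k + 2 := ⟨m - 2, by omega⟩
    change parity (m + 1) 0 (if c 0 = x then rt (m + 1) else 1) *
      parity (m + 1) 0 (sp (m + 1) (fun i => c (i + 1)) x) = _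
    rw [parity_zero_sp, mul_one]
    split_ifs
    · rfl
    · rfl
  | succ j ih =>
    obtain ⟨m, rfl⟩ : ∃ k, m = k + 1 := ⟨m - 1, by omega⟩
    change parity m (j + 1) (if c 0 = x then rt m else 1) *
      parity m (j + 1) (sp m (fun i => c (i + 1)) x) = _
    rw [ih (by omega)]
    split_ifs <;> simp [parity_rt]

/-- The order of the product of the swap and of the spine element of `x`, modulo the normal closure
of the other spine element. -/
def IsDihedralOrder (m : ℕ) (c : ℕ → Bool) (x : Bool) (o : ℕ) : Prop :=
  ∀ n, (rt m * sp m c x) ^ n ∈ relNormalClosure (wordGroup m c x) (sp m c (!x)) ↔ o ∣ n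

/-- A leading x turns the two elements into ⟨a, y⟩ and ⟨1, z⟩, and squaring the product of the swap
with ⟨a, y⟩ gives ⟨ya, ay⟩. -/
theorem IsDihedralOrder.succ {m : ℕ} {c : ℕ → Bool} {x : Bool} {o : ℕ}
    (h : IsDihedralOrder m (fun i => c (i + 1)) x o) (hc : c 0 = x) :
    IsDihedralOrder (m + 1) c x (2 * o) := by
  intro n
  rw [wordGroup_succ hc, sp_succ_head hc, sp_succ_of_ne (x := !x) (by simp [hc])]
  exact pow_mem_relNormalClosure_spinalStep (D := Port m) h n

theorem s_sp (m : ℕ) (c : ℕ → Bool) (x : Bool) : Wr.s (D := Port m) (sp (m + 1) c x) = false := rfl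

theorem rt_notMem (m : ℕ) (c : ℕ → Bool) (x : Bool) :
    rt (m + 1) ∉ relNormalClosure (wordGroup (m + 1) c x) (sp (m + 1) c (!x)) := fun h => by
  have := s_eq_false_of_mem_relNormalClosure (D := Port m) (s_sp m c (!x)) h
  exact absurd this (by simp [rt])

/-- At a depth governed by an occurrence of x the parity is nontrivial on the spine element of x and
kills the other one, hence also its normal closure. -/
theorem sp_notMem {m : ℕ} {c : ℕ → Bool} {x : Bool} (hv : Visible m c x) :
    sp m c x ∉ relNormalClosure (wordGroup m c x) (sp m c (!x)) := by
  obtain ⟨j, hj, hc⟩ := hv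
  intro h
  have hle : relNormalClosure (wordGroup m c x) (sp m c (!x)) ≤ (parity m (j + 1)).ker :=
    relNormalClosure_le_of_mem (by rw [MonoidHom.mem_ker, parity_sp hj]; simp [hc])
  have h1 := hle h
  rw [MonoidHom.mem_ker, parity_sp hj, if_pos hc] at h1
  exact absurd h1 (by decide)

theorem isDihedralOrder_two {m : ℕ} {c : ℕ → Bool} {x : Bool} (hv : ¬ Visible (m + 1) c x) :
    IsDihedralOrder (m + 1) c x 2 := by
  intro n
  rw [sp_eq_one hv, mul_one]
  rcases Nat.even_or_odd' n with ⟨k, rfl | rfl⟩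
  · rw [pow_mul, pow_two, rt_mul_self, one_pow]
    exact ⟨fun _ => dvd_mul_right 2 k, fun _ => one_mem _⟩
  · rw [pow_succ, pow_mul, pow_two, rt_mul_self, one_pow, one_mul]
    exact ⟨fun h => absurd h (rt_notMem m c x), fun h => absurd h (by omega)⟩

/-- Here the spine element of x is ⟨1, y⟩, so the square of its product with the swap is ⟨y, y⟩ and
the fourth power is 1. A parity applied to the sections shows that the square survives modulo the
normal closure. -/
theorem isDihedralOrder_four {m : ℕ} {c : ℕ → Bool} {x : Bool} (hc : c 0 ≠ x)
    (hv : Visible m (fun i => c (i + 1)) x) : IsDihedralOrder (m + 1) c x 4 := by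
  obtain ⟨j, hj, hcj⟩ := hv
  have hc' : c 0 = !x := by
    cases x <;> cases h : c 0 <;> simp_all
  intro n
  -- The other spine element is ⟨a, z⟩: the parity below the root kills a, and it kills z because
  -- the letter at that depth is x.
  have hle : relNormalClosure (wordGroup (m + 1) c x) (sp (m + 1) c (!x)) ≤
      (Wr.map (D := Port m) (parity m (j + 1))).ker := by
    refine relNormalClosure_le_of_mem ?_
    rw [MonoidHom.mem_ker, sp_succ_head hc']
    ext b
    · cases b
      · simp [parity_rt]
      · simp [parity_sp hj, hcj]
    · simp
  have hsp : sp (m + 1) c x = Wr.pair (1 : Port m) (sp m (fun i => c (i + 1)) x) :=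
    sp_succ_of_ne hc
  have hrt : rt (m + 1) = Wr.swap (Port m) := rfl
  have h2 : ∀ k, (rt (m + 1) * sp (m + 1) c x) ^ (2 * k) =
      Wr.pair (sp m (fun i => c (i + 1)) x ^ k) (sp m (fun i => c (i + 1)) x ^ k) := by
    intro k
    rw [hrt, hsp]
    refine (swap_mul_pair_pow (D := Port m) _ _ k).trans ?_
    simp
  rcases Nat.even_or_odd' n with ⟨k, rfl | rfl⟩
  · rw [h2]
    rcases Nat.even_or_odd' k with ⟨l, rfl | rfl⟩
    · rw [pow_mul, pow_two, sp_mul_self, one_pow]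
      refine ⟨fun _ => ⟨l, by ring⟩, fun _ => ?_⟩
      have : (Wr.pair (1 : Port m) 1) = (1 : Port (m + 1)) := Wr.pair_one
      rw [this]
      exact one_mem _
    · rw [pow_succ, pow_mul, pow_two, sp_mul_self, one_pow, one_mul]
      refine ⟨fun h => ?_, fun h => absurd h (by omega)⟩
      have h1 := hle h
      rw [MonoidHom.mem_ker] at h1
      have h3 := congrArg (fun g => g.sec true) h1
      simp [parity_sp hj, hcj] at h3
  · refine ⟨fun h => ?_, fun h => absurd h (by omega)⟩
    have := s_eq_false_of_mem_relNormalClosure (D := Port m) (s_sp m c (!x)) h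
    rw [hrt, hsp] at this
    exact absurd ((swap_mul_pair_pow_odd (D := Port m) _ _ k).symm.trans this) (by simp)

/-! ### The recursion for the orders of the finite quotients -/

theorem card_wordGroup_succ {m : ℕ} {c : ℕ → Bool} {x o : _} (hc : c 0 = x)
    (hv : Visible m (fun i => c (i + 1)) x) (ho : IsDihedralOrder m (fun i => c (i + 1)) x o) :
    Nat.card (wordGroup (m + 1) c x) * o = Nat.card (wordGroup m (fun i => c (i + 1)) x) ^ 2 := by
  obtain ⟨m, rfl⟩ : ∃ k, m = k + 1 := by
    obtain ⟨i, hi, -⟩ := hv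
    exact ⟨m - 1, by omega⟩
  rw [wordGroup_succ hc]
  exact card_spinalStep_of_notMem (rt_mul_self _) (sp_mul_self _ _ _) (rt_notMem m _ x)
    (sp_notMem hv) ho

theorem card_wordGroup_succ_of_not_visible {m : ℕ} {c : ℕ → Bool} {x : Bool} (hm : 1 ≤ m)
    (hc : c 0 = x) (hv : ¬ Visible m (fun i => c (i + 1)) x) :
    Nat.card (wordGroup (m + 1) c x) = 2 * Nat.card (wordGroup m (fun i => c (i + 1)) x) ^ 2 := by
  obtain ⟨m, rfl⟩ : ∃ k, m = k + 1 := ⟨m - 1, by omega⟩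
  rw [wordGroup_succ hc]
  refine card_spinalStep_of_mem (rt_mul_self _) (rt_notMem m _ x) ?_
  rw [sp_eq_one hv]
  exact one_mem _

theorem card_wordGroup_one (c : ℕ → Bool) (x : Bool) : Nat.card (wordGroup 1 c x) = 2 := by
  have h : ∀ y, sp 1 c y = 1 := fun y => sp_eq_one fun ⟨i, hi, _⟩ => by omega
  have h1 : rt 1 ≠ 1 := fun h => by
    have := congrArg (Wr.s (D := Port 0)) h
    exact absurd this (by simp [rt])
  rw [wordGroup, h, h, Set.pair_eq_singleton, Set.pair_comm, Subgroup.closure_insert_one,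
    ← Subgroup.zpowers_eq_closure, Nat.card_zpowers,
    orderOf_eq_prime (p := 2) (by rw [pow_two, rt_mul_self]) h1]

/-! ### Self-similarity of Aut T and truncation to finite trees -/

section Decomposition

/-- The function on words determined by a root label and two sections. -/
def wreathFun (u : Wr AutT) : List Bool → List Bool
  | [] => []
  | x :: w => (x ^^ u.s) :: (u.sec x).1 w

theorem wreathFun_mul (u v : Wr AutT) (w : List Bool) :
    wreathFun (u * v) w = wreathFun u (wreathFun v w) := by
  cases w with
  | nil => rfl
  | cons x w => simp [wreathFun, Bool.xor_comm u.s]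

theorem wreathFun_one (w : List Bool) : wreathFun 1 w = w := by
  cases w <;> simp [wreathFun]

theorem wreathFun_length (u : Wr AutT) (w : List Bool) : (wreathFun u w).length = w.length := by
  cases w with
  | nil => rfl
  | cons x w => simp [wreathFun, (u.sec x).2.1 w]

theorem wreathFun_prefix (u : Wr AutT) {v w : List Bool} (h : v <+: w) :
    wreathFun u v <+: wreathFun u w := by
  cases v with
  | nil => exact List.nil_prefix
  | cons x v =>
    obtain ⟨t, rfl⟩ := h
    exact (List.prefix_cons_inj _).2 (((u.sec x).2.2 _ _).2 (List.prefix_append v t))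

theorem wreathFun_inv_self (u : Wr AutT) (w : List Bool) : wreathFun u⁻¹ (wreathFun u w) = w := by
  rw [← wreathFun_mul, inv_mul_cancel, wreathFun_one]

theorem wreathFun_self_inv (u : Wr AutT) (w : List Bool) : wreathFun u (wreathFun u⁻¹ w) = w := by
  rw [← wreathFun_mul, mul_inv_cancel, wreathFun_one]

/-- A tree automorphism from a pair of inverse prefix preserving functions. -/
def autOfInverse (f f' : List Bool → List Bool) (h : ∀ w, f' (f w) = w) (h' : ∀ w, f (f' w) = w)
    (hl : ∀ w, (f w).length = w.length) (hp : ∀ {u v}, u <+: v → f u <+: f v)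
    (hp' : ∀ {u v}, u <+: v → f' u <+: f' v) : AutT :=
  ⟨⟨f, f', h, h'⟩, hl, fun u v => ⟨fun huv => by
    have := hp' huv
    change f' (f u) <+: f' (f v) at this
    rwa [h, h] at this, hp⟩⟩

/-- The homomorphism which assembles an automorphism from a root label and two sections. -/
def assemble : Wr AutT →* AutT where
  toFun u := autOfInverse (wreathFun u) (wreathFun u⁻¹) (wreathFun_inv_self u)
    (wreathFun_self_inv u) (wreathFun_length u) (wreathFun_prefix u) (wreathFun_prefix u⁻¹)
  map_one' := Subtype.ext (Equiv.ext wreathFun_one)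
  map_mul' u v := Subtype.ext (Equiv.ext (wreathFun_mul u v))

theorem assemble_cons (u : Wr AutT) (x : Bool) (w : List Bool) :
    (assemble u).1 (x :: w) = (x ^^ u.s) :: (u.sec x).1 w := rfl

theorem assemble_injective : Function.Injective assemble := by
  intro u v h
  have key : ∀ x w, (x ^^ u.s) :: (u.sec x).1 w = (x ^^ v.s) :: (v.sec x).1 w := fun x w => by
    rw [← assemble_cons, ← assemble_cons, h]
  refine Wr.ext (funext fun x => Subtype.ext (Equiv.ext fun w => ?_)) ?_
  · exact (List.cons.inj (key x w)).2
  · simpa using (List.cons.inj (key false [])).1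

theorem AutT.apply_nil (g : AutT) : g.1 [] = [] := List.length_eq_zero_iff.1 (g.2.1 [])

theorem AutT.inv_apply_apply (g : AutT) (w : List Bool) : (g⁻¹).1 (g.1 w) = w :=
  Equiv.symm_apply_apply g.1 w

theorem AutT.apply_inv_apply (g : AutT) (w : List Bool) : g.1 ((g⁻¹).1 w) = w :=
  Equiv.apply_symm_apply g.1 w

/-- The root label of an automorphism. -/
def rootLabel (g : AutT) : Bool := (g.1 [false]).headD false

theorem AutT.apply_singleton (g : AutT) (x : Bool) : g.1 [x] = [x ^^ rootLabel g] := by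
  obtain ⟨y, hy⟩ := List.length_eq_one_iff.1 (g.2.1 [false])
  obtain ⟨z, hz⟩ := List.length_eq_one_iff.1 (g.2.1 [true])
  have hne : y ≠ z := by
    rintro rfl
    have := g.1.injective (hy.trans hz.symm)
    simp at this
  cases x
  · simp [rootLabel, hy]
  · rw [hz, rootLabel, hy]
    cases y <;> cases z <;> simp_all

theorem AutT.apply_cons (g : AutT) (x : Bool) (w : List Bool) :
    g.1 (x :: w) = (x ^^ rootLabel g) :: (g.1 (x :: w)).tail := by
  have hp : g.1 [x] <+: g.1 (x :: w) := (g.2.2 _ _).2 (by simp)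
  rw [AutT.apply_singleton] at hp
  obtain ⟨t, ht⟩ := hp
  rw [← ht]
  rfl

theorem rootLabel_inv (g : AutT) : rootLabel g⁻¹ = rootLabel g := by
  have h1 := AutT.inv_apply_apply g [false]
  rw [AutT.apply_singleton, AutT.apply_singleton] at h1
  cases h : rootLabel g <;> cases h' : rootLabel g⁻¹ <;> simp_all

/-- The function on words by which an automorphism acts on the subtree at a letter. -/
def sectionFun (g : AutT) (x : Bool) (w : List Bool) : List Bool := (g.1 (x :: w)).tail

theorem cons_sectionFun (g : AutT) (x : Bool) (w : List Bool) :
    (x ^^ rootLabel g) :: sectionFun g x w = g.1 (x :: w) := (g.apply_cons x w).symm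

theorem sectionFun_inv_sectionFun (g : AutT) (x : Bool) (w : List Bool) :
    sectionFun g⁻¹ (x ^^ rootLabel g) (sectionFun g x w) = w := by
  rw [sectionFun, cons_sectionFun, AutT.inv_apply_apply]
  rfl

theorem sectionFun_prefix (g : AutT) (x : Bool) {v w : List Bool} (h : v <+: w) :
    sectionFun g x v <+: sectionFun g x w := by
  have h1 : g.1 (x :: v) <+: g.1 (x :: w) := (g.2.2 _ _).2 ((List.prefix_cons_inj x).2 h)
  rw [← cons_sectionFun, ← cons_sectionFun] at h1
  exact (List.prefix_cons_inj _).1 h1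

/-- The section of an automorphism at a letter. -/
def sectionAt (g : AutT) (x : Bool) : AutT :=
  autOfInverse (sectionFun g x) (sectionFun g⁻¹ (x ^^ rootLabel g))
    (sectionFun_inv_sectionFun g x)
    (fun w => by
      have := sectionFun_inv_sectionFun g⁻¹ (x ^^ rootLabel g) w
      simpa [rootLabel_inv] using this)
    (fun w => by simp [sectionFun, g.2.1]) (sectionFun_prefix g x) (sectionFun_prefix g⁻¹ _)

theorem assemble_surjective : Function.Surjective assemble := by
  intro g
  refine ⟨⟨sectionAt g, rootLabel g⟩, Subtype.ext (Equiv.ext fun w => ?_)⟩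
  cases w with
  | nil => exact g.apply_nil.symm
  | cons x w => exact cons_sectionFun g x w

/-- The self-similarity of the automorphism group of the binary tree. -/
noncomputable def wreathEquiv : Wr AutT ≃* AutT :=
  MulEquiv.ofBijective assemble ⟨assemble_injective, assemble_surjective⟩

theorem assemble_mem_levelStab_succ {u : Wr AutT} {m : ℕ} :
    assemble u ∈ levelStab (m + 1) ↔ u.s = false ∧ ∀ x, u.sec x ∈ levelStab m := by
  constructor
  · intro h
    have key : ∀ x (w : List Bool), w.length = m → (x ^^ u.s) = x ∧ (u.sec x).1 w = w :=
      fun x w hw => List.cons.inj (h (x :: w) (by simp [hw]))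
    refine ⟨?_, fun x w hw => (key x w hw).2⟩
    simpa using (key false (List.replicate m false) (by simp)).1
  · rintro ⟨hs, hx⟩ w hw
    cases w with
    | nil => rfl
    | cons x w =>
      rw [assemble_cons, hs, Bool.xor_false, hx x w (by simpa using hw)]

/-- The action of the automorphism group of the binary tree on its first levels. -/
noncomputable def trunc : ∀ m, AutT →* Port m
  | 0 => 1
  | m + 1 => (Wr.map (trunc m)).comp wreathEquiv.symm.toMonoidHom

theorem trunc_assemble (m : ℕ) (u : Wr AutT) :
    trunc (m + 1) (assemble u) = Wr.map (trunc m) u := by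
  change Wr.map (trunc m) (wreathEquiv.symm (wreathEquiv u)) = _
  rw [MulEquiv.symm_apply_apply]

/-- Together with surjectivity this replaces the quotients in `cardMod` by subgroups of finite
wreath products, where the recursion is available. -/
theorem ker_trunc (m : ℕ) : (trunc m).ker = levelStab m := by
  induction m with
  | zero =>
    ext g
    refine ⟨fun _ w hw => ?_, fun _ => rfl⟩
    rw [List.length_eq_zero_iff.1 hw]
    exact g.apply_nil
  | succ m ih =>
    ext g
    obtain ⟨u, rfl⟩ := assemble_surjective g
    rw [assemble_mem_levelStab_succ, MonoidHom.mem_ker, trunc_assemble, Wr.ext_iff, funext_iff,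
      and_comm]
    simp only [← ih, MonoidHom.mem_ker]
    rfl

theorem trunc_surjective (m : ℕ) : Function.Surjective (trunc m) := by
  induction m with
  | zero => exact fun g => ⟨1, rfl⟩
  | succ m ih =>
    intro p
    choose f hf using fun x => ih (p.sec x)
    exact ⟨assemble ⟨f, p.s⟩, by
      rw [trunc_assemble]
      exact Wr.ext (funext hf) rfl⟩

theorem cardMod_eq (G : Subgroup AutT) (m : ℕ) : cardMod G m = Nat.card (G.map (trunc m)) := by
  rw [← Subgroup.relIndex_ker, ker_trunc]
  rfl

theorem cardMod_top (m : ℕ) : cardMod ⊤ m = 2 ^ (2 ^ m - 1) := by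
  rw [cardMod_eq, Subgroup.map_top_of_surjective _ (trunc_surjective m), Subgroup.card_top,
    Port.card]

theorem assemble_swap : assemble (Wr.swap AutT) = rootElt := by
  refine Subtype.ext (Equiv.ext fun w => ?_)
  cases w with
  | nil => rfl
  | cons x w =>
    rw [assemble_cons]
    change (x ^^ true) :: w = (if (1 : ZMod 2) = 1 then !x else x) :: w
    simp

theorem assemble_pair {n : ℕ} (ω : DualSeq n) (b : LevelGroup n) :
    assemble (Wr.pair (if ω 0 b = 1 then rootElt else 1) (spineElt (ω.shift 1) b)) =
      spineElt ω b := by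
  refine Subtype.ext (Equiv.ext fun w => ?_)
  cases w with
  | nil => rfl
  | cons x w =>
    rw [assemble_cons]
    cases x
    · change false :: _ = false :: rootFun (ω 0 b) w
      congr 1
      rw [Wr.pair_false]
      split_ifs with h
      · rw [h]
        rfl
      · cases w with
        | nil => rfl
        | cons y w => simp [rootFun, h]
    · rfl

theorem trunc_rootElt (m : ℕ) : trunc m rootElt = rt m := by
  cases m with
  | zero => rfl
  | succ m =>
    rw [← assemble_swap, trunc_assemble]
    exact Wr.ext (funext fun _ => map_one _) rfl

end Decomposition

/-! ### Spinal groups of binary words -/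

section Letters

/-- The index of the basis vector of `B = C₂²` that corresponds to a letter. -/
def letterIndex (x : Bool) : Fin 2 := cond x 1 0

theorem letterIndex_injective : Function.Injective letterIndex := by decide

/-- The basis vector of `B = C₂²` that corresponds to a letter. -/
def letterVec (x : Bool) : LevelGroup 2 := Pi.single (letterIndex x) 1

/-- The sequence of coordinate functionals given by a sequence of letters. -/
def letterSeq (c : ℕ → Bool) : DualSeq 2 := fun k => LinearMap.proj (letterIndex (c k))

theorem letterSeq_letterVec (c : ℕ → Bool) (k : ℕ) (x : Bool) :
    letterSeq c k (letterVec x) = if c k = x then 1 else 0 := by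
  simp [letterSeq, letterVec, Pi.single_apply, letterIndex_injective.eq_iff]

theorem letterSeq_shift (c : ℕ → Bool) (k : ℕ) :
    (letterSeq c).shift k = letterSeq (fun i => c (i + k)) := rfl

theorem letterSeq_ne_zero (c : ℕ → Bool) (k : ℕ) : letterSeq c k ≠ 0 := fun h => by
  have := letterSeq_letterVec c k (c k)
  rw [h] at this
  simp at this

theorem trunc_spineElt (m : ℕ) (c : ℕ → Bool) (x : Bool) :
    trunc m (spineElt (letterSeq c) (letterVec x)) = sp m c x := by
  induction m generalizing c with
  | zero => rfl
  | succ m ih =>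
    rw [← assemble_pair, trunc_assemble, letterSeq_letterVec, letterSeq_shift]
    refine Wr.ext (funext fun y => ?_) rfl
    cases y
    · change trunc m (if (if c 0 = x then (1 : ZMod 2) else 0) = 1 then rootElt else 1) =
        if c 0 = x then rt m else 1
      split_ifs <;> simp_all [trunc_rootElt]
    · exact ih _

theorem rootFun_add (p q : ZMod 2) (w : List Bool) :
    rootFun (p + q) w = rootFun p (rootFun q w) := by
  cases w with
  | nil => rfl
  | cons x w =>
    have : ∀ p : ZMod 2, p = 0 ∨ p = 1 := by decide
    rcases this p with rfl | rfl <;> rcases this q with rfl | rfl <;>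
      simp [rootFun, show (1 : ZMod 2) + 1 = 0 from rfl]

theorem spineFun_add {n : ℕ} (b b' : LevelGroup n) (ω : DualSeq n) (w : List Bool) :
    spineFun (b + b') ω w = spineFun b ω (spineFun b' ω w) := by
  induction w generalizing ω with
  | nil => rfl
  | cons x w ih => cases x <;> simp [spineFun, rootFun_add, ih]

theorem spineElt_add {n : ℕ} (ω : DualSeq n) (b b' : LevelGroup n) :
    spineElt ω (b + b') = spineElt ω b * spineElt ω b' :=
  Subtype.ext (Equiv.ext (spineFun_add b b' ω))

theorem spineElt_zero {n : ℕ} (ω : DualSeq n) : spineElt ω 0 = 1 := by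
  have := spineElt_add ω 0 0
  rwa [add_zero, left_eq_mul] at this

theorem eq_letterVec (b : LevelGroup 2) :
    b = 0 ∨ b = letterVec false ∨ b = letterVec true ∨ b = letterVec false + letterVec true := by
  revert b
  decide

theorem spinalGroup_letterSeq (c : ℕ → Bool) :
    spinalGroup (letterSeq c) = Subgroup.closure {rootElt,
      spineElt (letterSeq c) (letterVec false), spineElt (letterSeq c) (letterVec true)} := by
  set S := Subgroup.closure {rootElt,
      spineElt (letterSeq c) (letterVec false), spineElt (letterSeq c) (letterVec true)} with hS
  have h0 : rootElt ∈ S := Subgroup.subset_closure (by simp)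
  have h1 : spineElt (letterSeq c) (letterVec false) ∈ S := Subgroup.subset_closure (by simp)
  have h2 : spineElt (letterSeq c) (letterVec true) ∈ S := Subgroup.subset_closure (by simp)
  refine le_antisymm ((Subgroup.closure_le _).2 ?_) (Subgroup.closure_mono ?_)
  · rintro g (hg | ⟨b, rfl⟩)
    · rw [hg]
      exact h0
    · rcases eq_letterVec b with rfl | rfl | rfl | rfl
      · rw [spineElt_zero]
        exact one_mem _
      · exact h1
      · exact h2
      · rw [spineElt_add]
        exact mul_mem h1 h2
  · rintro g (rfl | rfl | rfl)
    · exact Or.inl rfl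
    · exact Or.inr ⟨_, rfl⟩
    · exact Or.inr ⟨_, rfl⟩

theorem cardMod_spinalGroup (c : ℕ → Bool) (m : ℕ) (x : Bool) :
    cardMod (spinalGroup (letterSeq c)) m = Nat.card (wordGroup m c x) := by
  rw [cardMod_eq, spinalGroup_letterSeq, MonoidHom.map_closure, wordGroup_eq m c x false]
  simp [Set.image_insert_eq, trunc_rootElt, trunc_spineElt, wordGroup]

/-- The point is that the three generators are distinct: the root label isolates the swap, and the
parity at an occurrence of the letter `false` separates the two spine elements. -/
theorem exists_three_generators {c : ℕ → Bool} {i : ℕ} (hi : c i = false) :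
    ∃ S : Finset AutT, S.card = 3 ∧
      Subgroup.closure (S : Set AutT) = spinalGroup (letterSeq c) := by
  classical
  have hroot : ∀ x, rootElt ≠ spineElt (letterSeq c) (letterVec x) := fun x h => by
    have := congrArg (trunc 1) h
    rw [trunc_rootElt, trunc_spineElt] at this
    exact absurd (congrArg Wr.s this) (by simp [rt, sp])
  have hspine : spineElt (letterSeq c) (letterVec false) ≠
      spineElt (letterSeq c) (letterVec true) := fun h => by
    have h0 := congrArg (trunc (i + 2)) h
    rw [trunc_spineElt, trunc_spineElt] at h0
    have := congrArg (parity (i + 2) (i + 1)) h0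
    rw [parity_sp (by omega), parity_sp (by omega), hi] at this
    exact absurd this (by decide)
  refine ⟨{rootElt, spineElt (letterSeq c) (letterVec false),
    spineElt (letterSeq c) (letterVec true)}, ?_, ?_⟩
  · rw [Finset.card_insert_of_notMem (by simp [hroot]), Finset.card_pair hspine]
  · rw [spinalGroup_letterSeq, Finset.coe_insert, Finset.coe_pair]

/-- If both letters occur beyond every index, finitely many terms of each shift already contain both
coordinate functionals, which span the dual. -/
theorem diminf_letterSeq {c : ℕ → Bool} (h : ∀ k x, ∃ i, c (i + k) = x) :
    diminf (letterSeq c) = 2 := by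
  have hfin : Module.finrank (ZMod 2) (Module.Dual (ZMod 2) (LevelGroup 2)) = 2 := by
    rw [Subspace.dual_finrank_eq, Module.finrank_fin_fun]
  have key : ∀ k, ⨆ m, dimMod ((letterSeq c).shift k) m = 2 := by
    intro k
    have hle : ∀ m, dimMod ((letterSeq c).shift k) m ≤ 2 := fun m =>
      (Submodule.finrank_le _).trans hfin.le
    refine le_antisymm (ciSup_le hle) ?_
    obtain ⟨i, hi⟩ := h k false
    obtain ⟨j, hj⟩ := h k true
    refine le_trans ?_ (le_ciSup (f := fun m => dimMod ((letterSeq c).shift k) m)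
      ⟨2, by rintro _ ⟨m, rfl⟩; exact hle m⟩ (i + j + 2))
    have htop : Submodule.span (ZMod 2)
        ((letterSeq c).shift k '' {l | l < i + j + 2 - 1}) = ⊤ := by
      rw [eq_top_iff]
      intro f _
      have h1 : (LinearMap.proj 0 : Module.Dual (ZMod 2) (LevelGroup 2)) ∈ Submodule.span (ZMod 2)
          ((letterSeq c).shift k '' {l | l < i + j + 2 - 1}) :=
        Submodule.subset_span ⟨i, by change i < _; omega, by
          simp only [letterSeq_shift, letterSeq, hi]
          rfl⟩
      have h2 : (LinearMap.proj 1 : Module.Dual (ZMod 2) (LevelGroup 2)) ∈ Submodule.span (ZMod 2)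
          ((letterSeq c).shift k '' {l | l < i + j + 2 - 1}) :=
        Submodule.subset_span ⟨j, by change j < _; omega, by
          simp only [letterSeq_shift, letterSeq, hj]
          rfl⟩
      have hf : f = f (Pi.single 0 1) • LinearMap.proj 0 + f (Pi.single 1 1) • LinearMap.proj 1 := by
        refine LinearMap.pi_ext' fun l => LinearMap.ext_ring ?_
        fin_cases l <;> simp
      rw [hf]
      exact add_mem (Submodule.smul_mem _ _ h1) (Submodule.smul_mem _ _ h2)
    rw [dimMod, htop, finrank_top, hfin]
  simp only [diminf, key]
  exact Filter.liminf_const 2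

end Letters

/-! ### Aut T as a compact topological group -/

section Topology
open Filter Topology

instance levelStab_normal (m : ℕ) : (levelStab m).Normal := by
  rw [← ker_trunc]
  infer_instance

theorem levelStab_zero : levelStab 0 = ⊤ := by
  rw [← ker_trunc]
  exact MonoidHom.ker_one

/-- The diameter of the cosets of the stabilizer of a level. -/
noncomputable def levelDiam (m : ℕ) : ℝ≥0∞ := (2 : ℝ≥0∞)⁻¹ ^ (2 ^ m - 1)

theorem levelDiam_antitone : Antitone levelDiam := fun _ _ h =>
  pow_le_pow_right_of_le_one' (by simp) (Nat.sub_le_sub_right (Nat.pow_le_pow_right (by norm_num) h) 1)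

theorem levelDiam_pos (m : ℕ) : 0 < levelDiam m :=
  pos_iff_ne_zero.2 (pow_ne_zero _ (by simp))

theorem levelDiam_strictAnti : StrictAnti levelDiam := by
  refine strictAnti_nat_of_succ_lt fun m => ?_
  rw [levelDiam, levelDiam, ← ENNReal.rpow_natCast, ← ENNReal.rpow_natCast]
  refine ENNReal.rpow_lt_rpow_of_exponent_gt (by simp) (by norm_num) ?_
  have := Nat.one_le_two_pow (n := m)
  rw [Nat.cast_lt, pow_succ]
  omega

theorem tendsto_levelDiam : Tendsto levelDiam atTop (𝓝 0) := by
  refine tendsto_of_tendsto_of_tendsto_of_le_of_le tendsto_const_nhds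
    (ENNReal.tendsto_pow_atTop_nhds_zero_of_lt_one (r := (2 : ℝ≥0∞)⁻¹) (by norm_num))
    (fun _ => zero_le) fun m => ?_
  exact pow_le_pow_right_of_le_one' (by simp) (Nat.le_sub_one_of_lt Nat.lt_two_pow_self)

theorem edist_le_levelDiam {g h : AutT} {m : ℕ} (hm : g⁻¹ * h ∈ levelStab m) :
    edist g h ≤ levelDiam m := iInf₂_le m hm

/-- Elements that differ on level m+1 can agree at most up to level m; this is the source of the
shift by one. -/
theorem levelDiam_le_edist {g h : AutT} {m : ℕ} (hm : g⁻¹ * h ∉ levelStab (m + 1)) :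
    levelDiam m ≤ edist g h := by
  refine le_iInf₂ fun n hn => levelDiam_antitone ?_
  by_contra hlt
  exact hm (levelStab_anti (by omega) hn)

theorem mem_levelStab_of_edist_lt {g h : AutT} {m : ℕ} (hm : edist g h < levelDiam m) :
    g⁻¹ * h ∈ levelStab (m + 1) := by
  by_contra hn
  exact (levelDiam_le_edist hn).not_gt hm

theorem hasBasis_nhds_aut (g : AutT) :
    (𝓝 g).HasBasis (fun _ : ℕ => True) fun m => {h | g⁻¹ * h ∈ levelStab m} := by
  refine Metric.nhds_basis_eball.to_hasBasis (fun ε hε => ?_) fun m _ => ?_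
  · obtain ⟨m, hm⟩ := (tendsto_levelDiam.eventually_lt_const hε).exists
    refine ⟨m, trivial, fun h hh => ?_⟩
    rw [Metric.mem_eball, edist_comm]
    exact (edist_le_levelDiam hh).trans_lt hm
  · refine ⟨levelDiam m, levelDiam_pos m, fun h hh => ?_⟩
    rw [Metric.mem_eball, edist_comm] at hh
    exact levelStab_anti m.le_succ (mem_levelStab_of_edist_lt hh)

theorem isOpen_levelCoset (g : AutT) (m : ℕ) : IsOpen {h | g⁻¹ * h ∈ levelStab m} := by
  rw [isOpen_iff_mem_nhds]
  intro h hh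
  refine (hasBasis_nhds_aut h).mem_iff.2 ⟨m, trivial, fun k hk => ?_⟩
  have := mul_mem (show g⁻¹ * h ∈ levelStab m from hh) (show h⁻¹ * k ∈ levelStab m from hk)
  rwa [mul_assoc, mul_inv_cancel_left] at this

instance isTopologicalGroup_aut : IsTopologicalGroup AutT where
  continuous_mul := by
    rw [continuous_iff_continuousAt]
    rintro ⟨g, h⟩
    refine (((hasBasis_nhds_aut g).prod_nhds (hasBasis_nhds_aut h)).tendsto_iff
      (hasBasis_nhds_aut _)).2 fun m _ => ⟨⟨m, m⟩, ⟨trivial, trivial⟩, ?_⟩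
    rintro ⟨g', h'⟩ ⟨hg, hh⟩
    have h1 := (levelStab_normal m).conj_mem _ hg h⁻¹
    have h2 := mul_mem h1 hh
    change (g * h)⁻¹ * (g' * h') ∈ levelStab m
    convert h2 using 1
    simp only
    group
  continuous_inv := by
    rw [continuous_iff_continuousAt]
    intro g
    refine ((hasBasis_nhds_aut g).tendsto_iff (hasBasis_nhds_aut _)).2 fun m _ =>
      ⟨m, trivial, fun h hh => ?_⟩
    have h1 := (levelStab_normal m).conj_mem _ (inv_mem hh) g
    change g⁻¹⁻¹ * h⁻¹ ∈ levelStab m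
    convert h1 using 1
    group

theorem apply_eq_of_mem_levelStab {g h : AutT} {m : ℕ} (hm : g⁻¹ * h ∈ levelStab m) {w : List Bool}
    (hw : w.length ≤ m) : h.1 w = g.1 w := by
  have h1 : (g⁻¹ * h).1 w = w := levelStab_anti hw hm w rfl
  have h2 : (g⁻¹).1 (h.1 w) = w := h1
  rw [← g.apply_inv_apply (h.1 w), h2]

/-- Along a sufficiently fast Cauchy sequence the image of a word w is constant from the index |w|
on; these stable values define the limit and its inverse. -/
instance completeSpace_aut : CompleteSpace AutT := by
  refine EMetric.complete_of_convergent_controlled_sequences levelDiam levelDiam_pos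
    fun u hu => ?_
  have hmem : ∀ N n m, N ≤ n → N ≤ m → (u n)⁻¹ * u m ∈ levelStab N := fun N n m hn hm =>
    levelStab_anti N.le_succ (mem_levelStab_of_edist_lt (hu N n m hn hm))
  have happ : ∀ (w : List Bool) n, w.length ≤ n → (u n).1 w = (u w.length).1 w := fun w n hn =>
    apply_eq_of_mem_levelStab (hmem w.length w.length n le_rfl hn) le_rfl
  have happ' : ∀ (w : List Bool) n, w.length ≤ n → (u n)⁻¹.1 w = (u w.length)⁻¹.1 w :=
    fun w n hn => by
      refine (u n).1.injective ?_
      rw [(u n).apply_inv_apply, happ, (u w.length)⁻¹.2.1 w, (u w.length).apply_inv_apply]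
      rwa [(u w.length)⁻¹.2.1 w]
  let g : AutT := autOfInverse (fun w => (u w.length).1 w) (fun w => (u w.length)⁻¹.1 w)
    (fun w => by
      simp only [(u w.length).2.1 w]
      exact (u w.length).inv_apply_apply w)
    (fun w => by
      simp only [(u w.length)⁻¹.2.1 w]
      exact (u w.length).apply_inv_apply w)
    (fun w => (u w.length).2.1 w)
    (fun {v w} h => by
      rw [← happ v w.length h.length_le]
      exact ((u w.length).2.2 _ _).2 h)
    (fun {v w} h => by
      rw [← happ' v w.length h.length_le]
      exact ((u w.length)⁻¹.2.2 _ _).2 h)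
  refine ⟨g, (hasBasis_nhds_aut g).tendsto_right_iff.2 fun m _ => ?_⟩
  filter_upwards [eventually_ge_atTop m] with n hn w hw
  have h1 : (u n).1 w = g.1 w := happ w n (by omega)
  change g⁻¹.1 ((u n).1 w) = w
  rw [h1, g.inv_apply_apply]

theorem inv_mul_mem_levelStab_iff {g h : AutT} {m : ℕ} :
    g⁻¹ * h ∈ levelStab m ↔ trunc m g = trunc m h := by
  rw [← ker_trunc, MonoidHom.mem_ker, map_mul, map_inv, inv_mul_eq_one]

instance compactSpace_aut : CompactSpace AutT := by
  refine ⟨isCompact_iff_totallyBounded_isComplete.2 ⟨?_, isComplete_univ⟩⟩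
  refine EMetric.totallyBounded_iff.2 fun ε hε => ?_
  obtain ⟨m, hm⟩ := (tendsto_levelDiam.eventually_lt_const hε).exists
  refine ⟨Set.range (Function.surjInv (trunc_surjective m)), Set.finite_range _, fun g _ => ?_⟩
  refine Set.mem_iUnion₂.2 ⟨_, ⟨trunc m g, rfl⟩, ?_⟩
  rw [Metric.mem_eball]
  refine (edist_le_levelDiam ?_).trans_lt hm
  rw [inv_mul_mem_levelStab_iff, Function.surjInv_eq (trunc_surjective m)]

/-- Cosets of the level stabilizer are open, so every element of the closure agrees with an element
of G on the first m levels. -/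
theorem map_trunc_closure (G : Subgroup AutT) (m : ℕ) :
    G.topologicalClosure.map (trunc m) = G.map (trunc m) := by
  refine le_antisymm ?_ (Subgroup.map_mono G.le_topologicalClosure)
  rintro _ ⟨g, hg, rfl⟩
  obtain ⟨h, hh, hG⟩ := mem_closure_iff_nhds.1 hg _
    ((hasBasis_nhds_aut g).mem_of_mem (i := m) trivial)
  exact ⟨h, hG, (inv_mul_mem_levelStab_iff.1 hh).symm⟩

theorem cardMod_pos (G : Subgroup AutT) (m : ℕ) : 0 < cardMod G m := by
  rw [cardMod_eq]
  exact Nat.card_pos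

end Topology

/-! ### Hausdorff dimension as a liminf -/

section Measure
open MeasureTheory Measure Filter Topology
open scoped Pointwise

/-- The closure of a group of tree automorphisms carries a probability measure for which all cosets
of the stabilizer of a level have the same measure. -/
theorem exists_measure_closure [MeasurableSpace AutT] [BorelSpace AutT] (G : Subgroup AutT) :
    ∃ μ : Measure AutT, μ (closure (G : Set AutT)) = 1 ∧
      -- Only an upper bound holds for all g, since the coset may miss the closure.
      ∀ g m, μ {h | g⁻¹ * h ∈ levelStab m} ≤ (cardMod G m : ℝ≥0∞)⁻¹ := by
  set X := G.topologicalClosure with hX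
  have hXc : IsClosed (X : Set AutT) := G.isClosed_topologicalClosure
  have : CompactSpace X := isCompact_iff_compactSpace.1 hXc.isCompact
  let K : TopologicalSpace.PositiveCompacts X := ⊤
  let ν : Measure X := haarMeasure K
  have hν : ν Set.univ = 1 := haarMeasure_self (K₀ := K)
  have hval : Measurable (Subtype.val : X → AutT) := measurable_subtype_coe
  refine ⟨ν.map Subtype.val, ?_, fun g m => ?_⟩
  · rw [map_apply hval isClosed_closure.measurableSet, ← hν]
    congr 1
    exact Set.eq_univ_of_forall fun x => x.2
  · rw [map_apply hval (isOpen_levelCoset g m).measurableSet]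
    rcases Set.eq_empty_or_nonempty (Subtype.val ⁻¹' {h | g⁻¹ * h ∈ levelStab m} : Set X) with
      he | ⟨x, hx⟩
    · rw [he, measure_empty]
      exact zero_le
    · set H : Subgroup X := (levelStab m).subgroupOf X with hH
      have hidx : H.index = cardMod G m := by
        rw [cardMod_eq, ← map_trunc_closure, ← Subgroup.relIndex_ker, ker_trunc]
        rfl
      have : H.FiniteIndex := ⟨by rw [hidx]; exact (cardMod_pos G m).ne'⟩
      have hHm : MeasurableSet (H : Set X) := by
        have h1 : MeasurableSet (levelStab m : Set AutT) := by
          have := (isOpen_levelCoset 1 m).measurableSet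
          simpa using this
        exact hval h1
      -- A coset that meets the closure meets it in a translate of a subgroup of index |G mod m|,
      -- and Haar measure is invariant.
      have hset : (Subtype.val ⁻¹' {h | g⁻¹ * h ∈ levelStab m} : Set X) = x • (H : Set X) := by
        ext y
        rw [Set.mem_smul_set_iff_inv_smul_mem]
        change g⁻¹ * y.1 ∈ levelStab m ↔ x.1⁻¹ * y.1 ∈ levelStab m
        have hx' : g⁻¹ * x.1 ∈ levelStab m := hx
        rw [inv_mul_mem_levelStab_iff] at hx'
        rw [inv_mul_mem_levelStab_iff, inv_mul_mem_levelStab_iff, hx']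
      have hmul := H.index_mul_measure hHm ν
      rw [hν, hidx] at hmul
      rw [hset, measure_smul, ENNReal.le_inv_iff_mul_le, mul_comm, hmul]

theorem log_cardMod_top (m : ℕ) : Real.log (cardMod ⊤ m) = (2 ^ m - 1 : ℕ) * Real.log 2 := by
  rw [cardMod_top]
  push_cast
  rw [Real.log_pow]

theorem log_cardMod_top_pos {m : ℕ} (hm : 1 ≤ m) : 0 < Real.log (cardMod ⊤ m) := by
  rw [log_cardMod_top]
  have h1 : 1 < 2 ^ m := Nat.one_lt_two_pow (by omega)
  have : (0 : ℝ) < (2 ^ m - 1 : ℕ) := by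
    exact_mod_cast Nat.sub_pos_of_lt h1
  exact mul_pos this (Real.log_pos (by norm_num))

theorem levelDiam_rpow (m : ℕ) (s : ℝ) :
    levelDiam m ^ s = ENNReal.ofReal (Real.exp (-(s * Real.log (cardMod ⊤ m)))) := by
  have h1 : levelDiam m = ENNReal.ofReal ((2⁻¹ : ℝ) ^ (2 ^ m - 1)) := by
    rw [ENNReal.ofReal_pow (by norm_num), ENNReal.ofReal_inv_of_pos (by norm_num), levelDiam]
    simp
  rw [h1, ENNReal.ofReal_rpow_of_pos (by positivity), Real.rpow_def_of_pos (by positivity),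
    Real.log_pow, Real.log_inv, log_cardMod_top]
  congr 2
  ring

theorem cardMod_mul_rpow (G : Subgroup AutT) (m : ℕ) (s : ℝ) :
    (cardMod G m : ℝ≥0∞) * levelDiam m ^ s =
      ENNReal.ofReal (Real.exp (Real.log (cardMod G m) - s * Real.log (cardMod ⊤ m))) := by
  have hpos : (0 : ℝ) < cardMod G m := by exact_mod_cast cardMod_pos G m
  rw [levelDiam_rpow, sub_eq_add_neg, Real.exp_add, Real.exp_log hpos,
    ENNReal.ofReal_mul hpos.le, ENNReal.ofReal_natCast]

theorem cardMod_mul_rpow_le_one {G : Subgroup AutT} {m : ℕ} (hm : 1 ≤ m) {s : ℝ}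
    (h : Real.log (cardMod G m) / Real.log (cardMod ⊤ m) ≤ s) :
    (cardMod G m : ℝ≥0∞) * levelDiam m ^ s ≤ 1 := by
  rw [cardMod_mul_rpow, ENNReal.ofReal_le_one, Real.exp_le_one_iff, sub_nonpos]
  exact (div_le_iff₀ (log_cardMod_top_pos hm)).1 h

theorem inv_cardMod_le_rpow {G : Subgroup AutT} {m : ℕ} (hm : 1 ≤ m) {s : ℝ}
    (h : s ≤ Real.log (cardMod G m) / Real.log (cardMod ⊤ m)) :
    (cardMod G m : ℝ≥0∞)⁻¹ ≤ levelDiam m ^ s := by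
  have h1 : 1 ≤ (cardMod G m : ℝ≥0∞) * levelDiam m ^ s := by
    rw [cardMod_mul_rpow, ENNReal.one_le_ofReal, Real.one_le_exp_iff, sub_nonneg]
    exact (le_div_iff₀ (log_cardMod_top_pos hm)).1 h
  rw [ENNReal.inv_le_iff_le_mul]
  · exact h1
  · intro _
    exact_mod_cast (cardMod_pos G m).ne'
  · intro h0
    exact absurd h0 (ENNReal.natCast_ne_top _)

theorem dimRatio_nonneg (G : Subgroup AutT) (m : ℕ) :
    0 ≤ Real.log (cardMod G m) / Real.log (cardMod ⊤ m) :=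
  div_nonneg (Real.log_natCast_nonneg _) (Real.log_natCast_nonneg _)

theorem dimRatio_le_one (G : Subgroup AutT) (m : ℕ) :
    Real.log (cardMod G m) / Real.log (cardMod ⊤ m) ≤ 1 := by
  refine div_le_one_of_le₀ (Real.log_le_log (by exact_mod_cast cardMod_pos G m) ?_)
    (Real.log_natCast_nonneg _)
  rw [cardMod_eq, cardMod_eq]
  exact_mod_cast Nat.card_mono (Set.toFinite _) (Subgroup.map_mono le_top)

theorem isBoundedUnder_dimRatio (G : Subgroup AutT) : IsBoundedUnder (· ≥ ·) atTop
    fun m => Real.log (cardMod G m) / Real.log (cardMod ⊤ m) :=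
  isBoundedUnder_of ⟨0, dimRatio_nonneg G⟩

theorem isCoboundedUnder_dimRatio (G : Subgroup AutT) : IsCoboundedUnder (· ≥ ·) atTop
    fun m => Real.log (cardMod G m) / Real.log (cardMod ⊤ m) :=
  (isBoundedUnder_of ⟨1, dimRatio_le_one G⟩ : IsBoundedUnder (· ≤ ·) atTop _).isCoboundedUnder_ge

theorem liminfDim_nonneg (G : Subgroup AutT) : 0 ≤ liminfDim G :=
  le_liminf_of_le (isCoboundedUnder_dimRatio G) (Eventually.of_forall (dimRatio_nonneg G))

/-- The closure is covered by |G mod m| cosets of diameter at most 1/[Aut T : St(m)]. For infinitely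
many m the sum of the s-th powers of the diameters is at most 1, so the s-dimensional measure is
finite. -/
theorem hausdorffDim_le (G : Subgroup AutT) {s : ℝ} (hs : liminfDim G < s) :
    hausdorffDim G ≤ ENNReal.ofReal s := by
  borelize AutT
  have hs0 : 0 ≤ s := (liminfDim_nonneg G).trans hs.le
  have hfreq : ∃ᶠ m in atTop, Real.log (cardMod G m) / Real.log (cardMod ⊤ m) < s :=
    frequently_lt_of_liminf_lt (isCoboundedUnder_dimRatio G) hs
  let t : ∀ m : ℕ, G.map (trunc m) → Set AutT := fun m p => {h | trunc m h = p}
  let _ : ∀ m, Fintype (G.map (trunc m)) := fun m => Fintype.ofFinite _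
  have hdiam : ∀ m p, Metric.ediam (t m p) ≤ levelDiam m := fun m p =>
    Metric.ediam_le fun g hg h hh => edist_le_levelDiam <|
      inv_mul_mem_levelStab_iff.2 <| Eq.trans hg (Eq.symm hh)
  have hle := hausdorffMeasure_le_liminf_sum s (closure (G : Set AutT)) levelDiam
    tendsto_levelDiam t (Eventually.of_forall hdiam) (Eventually.of_forall fun m g hg => by
      have : trunc m g ∈ G.map (trunc m) := by
        rw [← map_trunc_closure]
        exact ⟨g, hg, rfl⟩
      exact Set.mem_iUnion.2 ⟨⟨_, this⟩, rfl⟩)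
  have hone : liminf (fun m => ∑ p, Metric.ediam (t m p) ^ s) atTop ≤ 1 := by
    refine liminf_le_of_frequently_le' ?_
    refine (hfreq.and_eventually (eventually_ge_atTop 1)).mono fun m hm => ?_
    refine le_trans (Finset.sum_le_sum fun p _ => ENNReal.rpow_le_rpow (hdiam m p) hs0) ?_
    rw [Finset.sum_const, Finset.card_univ, ← Nat.card_eq_fintype_card, ← cardMod_eq, nsmul_eq_mul]
    exact cardMod_mul_rpow_le_one hm.2 hm.1.le
  have hfin : μH[(s.toNNReal : ℝ)] (closure (G : Set AutT)) ≠ ∞ := by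
    rw [Real.coe_toNNReal s hs0]
    exact ((hle.trans hone).trans_lt ENNReal.one_lt_top).ne
  exact dimH_le_of_hausdorffMeasure_ne_top hfin

/-- Mass distribution principle: sets of small diameter have Haar measure at most the s-th power of
the diameter, so the s-dimensional measure of the closure is at least 1. -/
theorem le_hausdorffDim (G : Subgroup AutT) {s : ℝ} (hs0 : 0 < s) (hs : s < liminfDim G) :
    ENNReal.ofReal s ≤ hausdorffDim G := by
  borelize AutT
  obtain ⟨M, hM⟩ := eventually_atTop.1
    ((eventually_lt_of_lt_liminf hs (isBoundedUnder_dimRatio G)).and (eventually_ge_atTop 1))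
  have hinv : ∀ m ≥ M, (cardMod G m : ℝ≥0∞)⁻¹ ≤ levelDiam m ^ s := fun m hm =>
    inv_cardMod_le_rpow (hM m hm).2 (hM m hm).1.le
  obtain ⟨μ, hμ1, hμ⟩ := exists_measure_closure G
  have hle : μ ≤ μH[s] := by
    refine le_hausdorffMeasure s μ (levelDiam M) (levelDiam_pos M) fun t ht => ?_
    rcases t.eq_empty_or_nonempty with rfl | ⟨g, hg⟩
    · simp
    · by_cases hall : ∀ m, t ⊆ {h | g⁻¹ * h ∈ levelStab m}
      · have hzero : μ t ≤ 0 := by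
          have hlim : Tendsto (fun m => levelDiam m ^ s) atTop (𝓝 0) := by
            have := (ENNReal.continuous_rpow_const (y := s)).tendsto 0 |>.comp tendsto_levelDiam
            rwa [ENNReal.zero_rpow_of_pos hs0] at this
          refine ge_of_tendsto hlim ?_
          filter_upwards [eventually_ge_atTop M] with m hm
          exact ((measure_mono (hall m)).trans (hμ g m)).trans (hinv m hm)
        exact hzero.trans zero_le
      · push Not at hall
        classical
        -- The level k is the last on which all elements of t agree with g. The measure of t is then
        -- at most 1/|G mod k|, while its diameter is at least 1/[Aut T : St(k)].
        obtain ⟨k, hk⟩ : ∃ k, Nat.find hall = k + 1 := by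
          refine Nat.exists_eq_succ_of_ne_zero fun h0 => ?_
          have := Nat.find_spec hall
          rw [h0, levelStab_zero] at this
          exact this fun _ _ => trivial
        have hsub : t ⊆ {h | g⁻¹ * h ∈ levelStab k} := by
          have := Nat.find_min hall (m := k) (by omega)
          exact not_not.1 this
        have hnot := Nat.find_spec hall
        rw [hk] at hnot
        obtain ⟨h, hht, hh⟩ := Set.not_subset.1 hnot
        have hdk : levelDiam k ≤ Metric.ediam t :=
          (levelDiam_le_edist hh).trans (Metric.edist_le_ediam_of_mem hg hht)
        have hMk : M ≤ k := levelDiam_strictAnti.le_iff_ge.1 (hdk.trans ht)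
        exact ((measure_mono hsub).trans (hμ g k)).trans
          ((hinv k hMk).trans (ENNReal.rpow_le_rpow hdk hs0.le))
  have hne : μH[(s.toNNReal : ℝ)] (closure (G : Set AutT)) ≠ 0 := by
    rw [Real.coe_toNNReal s hs0.le]
    refine fun h0 => ?_
    have := hle (closure (G : Set AutT))
    rw [h0, hμ1] at this
    exact absurd this (by simp)
  exact le_dimH_of_hausdorffMeasure_ne_zero hne

/-- The Hausdorff dimension of a group of tree automorphisms is its lower box dimension. -/
theorem hausdorffDim_toReal (G : Subgroup AutT) : (hausdorffDim G).toReal = liminfDim G := by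
  have h : hausdorffDim G = ENNReal.ofReal (liminfDim G) := by
    refine le_antisymm ?_ ?_
    · refine ge_of_tendsto (x := 𝓝[>] (liminfDim G)) (f := fun s => ENNReal.ofReal s) ?_ ?_
      · exact (ENNReal.continuous_ofReal.tendsto _).mono_left nhdsWithin_le_nhds
      · filter_upwards [self_mem_nhdsWithin] with s hs
        exact hausdorffDim_le G hs
    · rcases (liminfDim_nonneg G).eq_or_lt with h0 | h0
      · rw [← h0, ENNReal.ofReal_zero]
        exact zero_le
      · refine le_of_tendsto (x := 𝓝[<] (liminfDim G)) (f := fun s => ENNReal.ofReal s) ?_ ?_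
        · exact (ENNReal.continuous_ofReal.tendsto _).mono_left nhdsWithin_le_nhds
        · filter_upwards [Ioo_mem_nhdsLT h0] with s hs
          exact le_hausdorffDim G hs.1 hs.2
  rw [h, ENNReal.toReal_ofReal (liminfDim_nonneg G)]

end Measure

/-! ### Growth of the finite quotients along a word -/

section Growth

/-- The binary logarithm of the order of the group acting on the first `m` levels. -/
noncomputable def logCard (m : ℕ) (c : ℕ → Bool) : ℝ :=
  Real.logb 2 (Nat.card (wordGroup m c false))

theorem logCard_eq (m : ℕ) (c : ℕ → Bool) (x : Bool) :
    logCard m c = Real.logb 2 (Nat.card (wordGroup m c x)) := by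
  rw [logCard, wordGroup_eq m c x false]

theorem card_wordGroup_ne_zero (m : ℕ) (c : ℕ → Bool) (x : Bool) :
    (Nat.card (wordGroup m c x) : ℝ) ≠ 0 := by
  exact_mod_cast Nat.card_pos.ne'

/-- The defect in the recursion for `logCard`. -/
noncomputable def defect (m : ℕ) (c : ℕ → Bool) : ℝ :=
  logCard (m + 1) c - 2 * logCard m (fun i => c (i + 1))

theorem logCard_one (c : ℕ → Bool) : logCard 1 c = 1 := by
  rw [logCard, card_wordGroup_one, Nat.cast_ofNat, Real.logb_self_eq_one (by norm_num)]

theorem defect_of_not_visible {m : ℕ} {c : ℕ → Bool} (hm : 1 ≤ m)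
    (hv : ¬ Visible m (fun i => c (i + 1)) (c 0)) : defect m c = 1 := by
  rw [defect, logCard_eq _ _ (c 0), logCard_eq _ _ (c 0),
    card_wordGroup_succ_of_not_visible hm rfl hv, Nat.cast_mul, Nat.cast_pow,
    Real.logb_mul (by norm_num) (pow_ne_zero _ (card_wordGroup_ne_zero _ _ _)), Real.logb_pow,
    Nat.cast_ofNat, Real.logb_self_eq_one (by norm_num)]
  ring

theorem defect_of_visible {m k : ℕ} {c : ℕ → Bool}
    (hv : Visible m (fun i => c (i + 1)) (c 0))
    (ho : IsDihedralOrder m (fun i => c (i + 1)) (c 0) (2 ^ k)) : defect m c = -k := by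
  have h := congrArg (fun n : ℕ => Real.logb 2 n) (card_wordGroup_succ rfl hv ho)
  simp only [Nat.cast_mul, Nat.cast_pow, Nat.cast_ofNat] at h
  rw [Real.logb_mul (card_wordGroup_ne_zero _ _ _) (by positivity), Real.logb_pow, Real.logb_pow,
    Real.logb_self_eq_one (by norm_num), mul_one] at h
  rw [defect, logCard_eq _ _ (c 0), logCard_eq _ _ (c 0)]
  push_cast at h
  linarith

theorem defect_one (c : ℕ → Bool) : defect 1 c = 1 :=
  defect_of_not_visible le_rfl fun ⟨i, hi, _⟩ => by omega

theorem defect_of_ne {m : ℕ} {c : ℕ → Bool} (h : c 1 ≠ c 0)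
    (hv : Visible m (fun i => c (i + 1)) (c 0)) : defect m c = -2 := by
  obtain ⟨m, rfl⟩ : ∃ k, m = k + 1 := by
    obtain ⟨i, hi, -⟩ := hv
    exact ⟨m - 1, by omega⟩
  have hv' : Visible m (fun i => c (i + 1 + 1)) (c 0) := by
    obtain ⟨i, hi, hc⟩ := hv
    cases i with
    | zero => exact absurd hc h
    | succ i => exact ⟨i, by omega, hc⟩
  have := defect_of_visible (k := 2) hv (isDihedralOrder_four h hv')
  exact_mod_cast this

/-- The dihedral order is taken in the shifted word, which begins with a run of exactly one letter c
0: the value 4 past the run doubles once to 8 = 2³. -/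
theorem defect_of_eq_of_visible {k : ℕ} {c : ℕ → Bool} (h1 : c 1 = c 0) (h2 : c 2 ≠ c 0)
    (hv : Visible k (fun i => c (i + 3)) (c 0)) : defect (k + 2) c = -3 := by
  have ho : IsDihedralOrder (k + 1) (fun i => c (i + 1 + 1)) (c 0) 4 :=
    isDihedralOrder_four (c := fun i => c (i + 1 + 1)) h2 hv
  have hv' : Visible (k + 2) (fun i => c (i + 1)) (c 0) := ⟨0, by omega, h1⟩
  have ho' : IsDihedralOrder (k + 2) (fun i => c (i + 1)) (c 0) (2 ^ 3) := by
    rw [show 2 ^ 3 = 2 * 4 by norm_num]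
    exact IsDihedralOrder.succ (c := fun i => c (i + 1)) ho h1
  have := defect_of_visible hv' ho'
  exact_mod_cast this

/-- As before, except that the order past the run is 2, because the letter is not seen again. -/
theorem defect_of_eq_of_not_visible {k : ℕ} {c : ℕ → Bool} (h1 : c 1 = c 0) (h2 : c 2 ≠ c 0)
    (hv : ¬ Visible k (fun i => c (i + 3)) (c 0)) : defect (k + 2) c = -2 := by
  have ho : IsDihedralOrder (k + 1) (fun i => c (i + 1 + 1)) (c 0) 2 := by
    refine isDihedralOrder_two (c := fun i => c (i + 1 + 1)) ?_
    rintro ⟨i, hi, hc⟩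
    cases i with
    | zero => exact h2 hc
    | succ i => exact hv ⟨i, by omega, hc⟩
  have hv' : Visible (k + 2) (fun i => c (i + 1)) (c 0) := ⟨0, by omega, h1⟩
  have ho' : IsDihedralOrder (k + 2) (fun i => c (i + 1)) (c 0) (2 ^ 2) := by
    rw [show 2 ^ 2 = 2 * 2 by norm_num]
    exact IsDihedralOrder.succ (c := fun i => c (i + 1)) ho h1
  have := defect_of_visible hv' ho'
  exact_mod_cast this

/-! ### Words without cubes -/

/-- No letter occurs three times in a row. -/
def NoCube (c : ℕ → Bool) : Prop := ∀ i, ¬ (c i = c (i + 1) ∧ c (i + 1) = c (i + 2))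

theorem NoCube.shift {c : ℕ → Bool} (h : NoCube c) (t : ℕ) : NoCube fun i => c (i + t) :=
  fun i => by simpa only [Nat.add_right_comm] using h (i + t)

theorem NoCube.exists_eq {c : ℕ → Bool} (h : NoCube c) (k : ℕ) (x : Bool) :
    ∃ i ≤ 2, c (k + i) = x := by
  by_contra! hn
  have h0 := hn 0 (by norm_num)
  have h1 := hn 1 (by norm_num)
  have h2 := hn 2 (by norm_num)
  have e0 : c k = !x := Bool.eq_not.2 h0
  have e1 : c (k + 1) = !x := Bool.eq_not.2 h1
  have e2 : c (k + 2) = !x := Bool.eq_not.2 h2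
  exact h k ⟨e0.trans e1.symm, e1.trans e2.symm⟩

theorem NoCube.ne_two {c : ℕ → Bool} (h : NoCube c) (h1 : c 1 = c 0) : c 2 ≠ c 0 :=
  fun h2 => h 0 ⟨h1.symm, h1.trans h2.symm⟩

/-- Without cubes a run has length at most two, so the dihedral order is at most 8. -/
theorem neg_three_le_defect {m : ℕ} {c : ℕ → Bool} (hm : 1 ≤ m) (h : NoCube c) :
    -3 ≤ defect m c := by
  by_cases hv : Visible m (fun i => c (i + 1)) (c 0)
  · by_cases h1 : c 1 = c 0
    · obtain ⟨k, rfl⟩ : ∃ k, m = k + 2 := by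
        obtain ⟨i, hi, -⟩ := hv
        exact ⟨m - 2, by omega⟩
      by_cases hv' : Visible k (fun i => c (i + 3)) (c 0)
      · exact (defect_of_eq_of_visible h1 (h.ne_two h1) hv').ge
      · rw [defect_of_eq_of_not_visible h1 (h.ne_two h1) hv']
        norm_num
    · rw [defect_of_ne h1 hv]
      norm_num
  · rw [defect_of_not_visible hm hv]
    norm_num

theorem visible_of_noCube {m : ℕ} {c : ℕ → Bool} (hm : 4 ≤ m) (h : NoCube c) (x : Bool) :
    Visible m c x := by
  obtain ⟨i, hi, hc⟩ := h.exists_eq 0 x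
  exact ⟨i, by omega, by simpa using hc⟩

theorem defect_of_ne_of_four_le {m : ℕ} {c : ℕ → Bool} (hm : 4 ≤ m) (h : NoCube c)
    (h1 : c 1 ≠ c 0) : defect m c = -2 :=
  defect_of_ne h1 (visible_of_noCube hm (h.shift 1) _)

theorem defect_of_eq_of_five_le {m : ℕ} {c : ℕ → Bool} (hm : 5 ≤ m) (h : NoCube c)
    (h1 : c 1 = c 0) : defect m c = -3 := by
  obtain ⟨k, rfl⟩ : ∃ k, m = k + 2 := ⟨m - 2, by omega⟩
  refine defect_of_eq_of_visible h1 (h.ne_two h1) ?_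
  obtain ⟨i, hi, hc⟩ := h.exists_eq 2 (c 0)
  cases i with
  | zero => exact absurd hc (h.ne_two h1)
  | succ i => exact ⟨i, by omega, by
      change c (i + 3) = c 0
      rw [← hc]
      congr 1
      omega⟩

theorem defect_two_of_ne {c : ℕ → Bool} (h1 : c 1 ≠ c 0) : defect 2 c = 1 :=
  defect_of_not_visible (by norm_num) fun ⟨i, hi, hc⟩ => by
    obtain rfl : i = 0 := by omega
    exact h1 hc

theorem defect_two_of_eq {c : ℕ → Bool} (h : NoCube c) (h1 : c 1 = c 0) : defect 2 c = -2 :=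
  defect_of_eq_of_not_visible (k := 0) h1 (h.ne_two h1) fun ⟨i, hi, _⟩ => by omega

/-- The absence of cubes forces c 0 to differ from the pair that follows, and only that pair is
visible after the shift. -/
theorem defect_three {c : ℕ → Bool} (h : NoCube c) (h1 : c 2 = c 1) : defect 3 c = 1 := by
  have h0 : c 1 ≠ c 0 := fun h0 => h 0 ⟨h0.symm, h1.symm⟩
  refine defect_of_not_visible (by norm_num) ?_
  rintro ⟨i, hi, hc⟩
  obtain rfl | rfl : i = 0 ∨ i = 1 := by omega
  · exact h0 hc
  · exact h0 (h1.symm.trans hc)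

/-- The normalised logarithm of the order of the group acting on the first `n + 1` levels. -/
noncomputable def density (n : ℕ) (c : ℕ → Bool) : ℝ := logCard (n + 1) c / 2 ^ (n + 1)

/-- Unfold the recursion down to one level, where the order is 2. The term s belongs to the suffix
that starts at n - 1 - s, so the last visible letters carry the largest weights. -/
theorem density_eq_sum (n : ℕ) (c : ℕ → Bool) : density n c =
    1 / 2 + ∑ s ∈ Finset.range n, defect (s + 1) (fun i => c (i + (n - 1 - s))) / 2 ^ (s + 2) := by
  induction n generalizing c with
  | zero => simp [density, logCard_one]
  | succ n ih =>
    have h : density (n + 1) c = density n (fun i => c (i + 1)) + defect (n + 1) c / 2 ^ (n + 2) := by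
      rw [density, density, defect]
      field_simp
      ring
    rw [h, ih, Finset.sum_range_succ, add_assoc]
    congr 2
    · refine Finset.sum_congr rfl fun s hs => ?_
      rw [Finset.mem_range] at hs
      have : n + 1 - 1 - s = n - 1 - s + 1 := by omega
      simp only [this, ← add_assoc]
    · simp

theorem sum_range_inv_pow (p k : ℕ) :
    ∑ r ∈ Finset.range p, (1 : ℝ) / 2 ^ (r + k + 1) = 1 / 2 ^ k - 1 / 2 ^ (p + k) := by
  induction p with
  | zero => simp
  | succ p ih =>
    rw [Finset.sum_range_succ, ih]
    field_simp
    ring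

/-- The last two visible letters both have defect 1 and all the others at least -3, so the density
is at least 1/2 + 1/4 + 1/8 - 3/8. -/
theorem half_le_density {n : ℕ} {c : ℕ → Bool} (hn : 2 ≤ n) (h : NoCube c)
    (hc : c (n - 1) ≠ c (n - 2)) : 1 / 2 ≤ density n c := by
  obtain ⟨p, rfl⟩ : ∃ p, n = 2 + p := ⟨n - 2, by omega⟩
  rw [density_eq_sum, Finset.sum_range_add, Finset.sum_range_succ, Finset.sum_range_one, defect_one,
    defect_two_of_ne (by
      convert hc using 2 <;> omega)]
  have hle : ∑ r ∈ Finset.range p, -3 * ((1 : ℝ) / 2 ^ (r + 3 + 1)) ≤ ∑ r ∈ Finset.range p,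
      defect (2 + r + 1) (fun i => c (i + (2 + p - 1 - (2 + r)))) / 2 ^ (2 + r + 2) := by
    refine Finset.sum_le_sum fun r _ => ?_
    rw [mul_one_div, show 2 + r + 2 = r + 3 + 1 by omega]
    exact div_le_div_of_nonneg_right (neg_three_le_defect (by omega) (h.shift _)) (by positivity)
  rw [← Finset.mul_sum, sum_range_inv_pow] at hle
  have : (0 : ℝ) < 1 / 2 ^ (p + 3) := by positivity
  generalize (1 : ℝ) / 2 ^ (p + 3) = q at hle this
  norm_num at hle ⊢
  linarith

/-- The density if the visible word ends with a repeated letter. -/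
theorem density_of_eq {p : ℕ} {c : ℕ → Bool} (h : NoCube c) (hc : c (p + 2) = c (p + 3))
    (hp : c p ≠ c (p + 1)) : density (4 + p) c = 7 / 16 + 1 / 2 ^ (p + 4) -
      1 / 8 * ∑ k ∈ Finset.range p, if c k = c (k + 1) then ((1 : ℝ) / 2) ^ (p + 2 - k) else 0 := by
  rw [density_eq_sum, Finset.sum_range_add]
  -- A defect of -2 is the base cost, giving the geometric series; a repeat costs one more unit,
  -- 1/2^(r+6), written as 1/8 times a power of 1/2 in the distance to the repeat at p+2.
  have hterm : ∀ r ∈ Finset.range p,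
      defect (4 + r + 1) (fun i => c (i + (4 + p - 1 - (4 + r)))) / 2 ^ (4 + r + 2) =
        -(1 / 2 ^ (r + 4 + 1)) - 1 / 8 * (if c (p - 1 - r) = c (p - 1 - r + 1) then
          ((1 : ℝ) / 2) ^ (p + 2 - (p - 1 - r)) else 0) := by
    intro r hr
    rw [Finset.mem_range] at hr
    have h1 : 4 + p - 1 - (4 + r) = p - 1 - r := by omega
    have h2 : p + 2 - (p - 1 - r) = r + 3 := by omega
    rw [h1, h2]
    split_ifs with hk
    · rw [defect_of_eq_of_five_le (by omega) (h.shift _) (by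
        simp only [zero_add]
        rw [hk, add_comm])]
      rw [one_div_pow]
      field_simp
      ring
    · rw [defect_of_ne_of_four_le (by omega) (h.shift _) (by
        simp only [zero_add]
        rw [add_comm]
        exact fun h => hk h.symm)]
      field_simp
      ring
  rw [Finset.sum_congr rfl hterm, Finset.sum_sub_distrib, Finset.sum_neg_distrib,
    sum_range_inv_pow, ← Finset.mul_sum,
    Finset.sum_range_reflect (fun k => if c k = c (k + 1) then ((1 : ℝ) / 2) ^ (p + 2 - k) else 0)]
  -- Near the end of the visible word the defects are 1, -2, 1, -2, whose weighted contributions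
  -- cancel; the constant 7/16 is 1/2 minus the 1/16 of the geometric series.
  have e1 : defect (0 + 1) (fun i => c (i + (4 + p - 1 - 0))) = 1 := defect_one _
  have e2 : defect (1 + 1) (fun i => c (i + (4 + p - 1 - 1))) = -2 := by
    refine defect_two_of_eq (h.shift _) ?_
    simp only [show 1 + (4 + p - 1 - 1) = p + 3 by omega, show 0 + (4 + p - 1 - 1) = p + 2 by omega]
    exact hc.symm
  have e3 : defect (2 + 1) (fun i => c (i + (4 + p - 1 - 2))) = 1 := by
    refine defect_three (h.shift _) ?_
    simp only [show 2 + (4 + p - 1 - 2) = p + 3 by omega, show 1 + (4 + p - 1 - 2) = p + 2 by omega]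
    exact hc.symm
  have e4 : defect (3 + 1) (fun i => c (i + (4 + p - 1 - 3))) = -2 := by
    refine defect_of_ne_of_four_le (by norm_num) (h.shift _) ?_
    simp only [show 1 + (4 + p - 1 - 3) = p + 1 by omega, show 0 + (4 + p - 1 - 3) = p by omega]
    exact hp.symm
  rw [Finset.sum_range_succ, Finset.sum_range_succ, Finset.sum_range_succ, Finset.sum_range_one,
    e1, e2, e3, e4]
  ring

end Growth

/-! ### The word with repeats at factorial positions -/

section FactorialWord
open Filter Topology

/-- The positions at which a letter of the word is repeated: the factorials `K!` and the
differences `K! - j!`. -/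
def IsRepeatPos (i : ℕ) : Prop :=
  ∃ L ≥ 2, i = (L + 1).factorial ∨ ∃ j, 3 ≤ j ∧ j ≤ L ∧ i + j.factorial = (L + 1).factorial

theorem six_le_factorial {n : ℕ} (h : 3 ≤ n) : 6 ≤ n.factorial := Nat.factorial_le h

theorem IsRepeatPos.six_le {i : ℕ} (h : IsRepeatPos i) : 6 ≤ i := by
  obtain ⟨L, hL, rfl | ⟨j, hj, hjL, hi⟩⟩ := h
  · exact six_le_factorial (by omega)
  · have h1 := Nat.factorial_le hjL
    have h2 := six_le_factorial (hj.trans hjL)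
    rw [Nat.factorial_succ] at hi
    nlinarith

/-- The repeats come in blocks, one for each factorial. The block of (M+1)! lies above M!, so below
(L+1)! only its own block reaches beyond L!. -/
theorem IsRepeatPos.cases_of_lt {k L : ℕ} (hk : IsRepeatPos k) (h : k < (L + 1).factorial) :
    k ≤ L.factorial ∨ ∃ j, 3 ≤ j ∧ j ≤ L ∧ k + j.factorial = (L + 1).factorial := by
  obtain ⟨M, hM, rfl | ⟨j, hj, hjM, hk⟩⟩ := hk
  · left
    refine Nat.factorial_le ?_
    by_contra hn
    exact h.not_ge (Nat.factorial_le (by omega))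
  · rcases lt_trichotomy M L with hML | rfl | hML
    · left
      have := Nat.factorial_le (show M + 1 ≤ L by omega)
      omega
    · exact Or.inr ⟨j, hj, hjM, hk⟩
    · exfalso
      have h1 := Nat.factorial_le hjM
      have h2 := Nat.factorial_le (show L + 1 ≤ M by omega)
      rw [Nat.factorial_succ M] at hk
      nlinarith

/-- The predecessor of (L+1)! - j! is at most L! or is (L+1)! - l! with l > j, and either way the
gap is a multiple of a factorial that is at least 6. -/
theorem IsRepeatPos.add_twelve_le {i j k L : ℕ} (hk : IsRepeatPos k) (hj : 3 ≤ j) (hjL : j ≤ L)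
    (hi : i + j.factorial = (L + 1).factorial) (hki : k < i) : k + 12 ≤ i := by
  have h1 := Nat.factorial_le hjL
  have h2 := six_le_factorial (hj.trans hjL)
  rcases hk.cases_of_lt (L := L) (by omega) with h | ⟨l, hl, hlL, hk'⟩
  · rw [Nat.factorial_succ] at hi
    nlinarith
  · have h3 : j < l := by
      by_contra hn
      have := Nat.factorial_le (show l ≤ j by omega)
      omega
    have h4 := Nat.factorial_le (show j + 1 ≤ l by omega)
    have h5 := six_le_factorial hj
    rw [Nat.factorial_succ j] at h4
    nlinarith

/-- The least gap comes from K! - 3! and K!. Gaps larger than 2 exclude cubes and make the density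
formula apply at every repeat. -/
theorem IsRepeatPos.add_six_le {i k : ℕ} (hk : IsRepeatPos k) (hi : IsRepeatPos i) (hki : k < i) :
    k + 6 ≤ i := by
  obtain ⟨L, hL, rfl | ⟨j, hj, hjL, hi⟩⟩ := hi
  · rcases hk.cases_of_lt hki with h | ⟨j, hj, -, hk'⟩
    · have h6 := hk.six_le
      rw [Nat.factorial_succ]
      nlinarith
    · have := six_le_factorial hj
      omega
  · have := hk.add_twelve_le hj hjL hi hki
    omega

open Classical in
/-- The sequence of letters, in which exactly the letters at the given positions are repeated. -/
noncomputable def factorialWord : ℕ → Bool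
  | 0 => false
  | i + 1 => if IsRepeatPos i then factorialWord i else !factorialWord i

theorem factorialWord_eq_iff (i : ℕ) :
    factorialWord i = factorialWord (i + 1) ↔ IsRepeatPos i := by
  rw [factorialWord]
  split_ifs with h <;> simp [h]

theorem factorialWord_noCube : NoCube factorialWord := by
  rintro i ⟨h1, h2⟩
  rw [factorialWord_eq_iff] at h1
  rw [show i + 2 = i + 1 + 1 from rfl, factorialWord_eq_iff] at h2
  have := h1.add_six_le h2 (by omega)
  omega

open Classical in
/-- The sum of the powers `2 ^ (k - i)` over the repeated positions `k < i`. -/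
noncomputable def repeatSum (i : ℕ) : ℝ :=
  ∑ k ∈ Finset.range i, if IsRepeatPos k then ((1 : ℝ) / 2) ^ (i - k) else 0

/-- The sum of `2 ^ (-j!)` over `3 ≤ j < K`. -/
noncomputable def factorialSum (K : ℕ) : ℝ := ∑ j ∈ Finset.Ico 3 K, ((1 : ℝ) / 2) ^ j.factorial

theorem sum_half_pow_le {b i : ℕ} (h : b ≤ i) :
    ∑ k ∈ Finset.range b, ((1 : ℝ) / 2) ^ (i - k) ≤ (1 / 2) ^ (i - b) := by
  induction b with
  | zero => simp
  | succ b ih =>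
    have h1 := ih (by omega)
    have h2 : i - b = (i - (b + 1)) + 1 := by omega
    rw [Finset.sum_range_succ]
    rw [h2, pow_succ] at h1 ⊢
    linarith

/-- The repeat K! - j! lies at distance j! from K! and contributes exactly 2^(-j!). -/
theorem factorialSum_le_repeatSum {L : ℕ} (hL : 2 ≤ L) :
    factorialSum (L + 1) ≤ repeatSum (L + 1).factorial := by
  classical
  rw [repeatSum, ← Finset.sum_filter, factorialSum]
  have hlt : ∀ j ∈ Finset.Ico 3 (L + 1), j.factorial < (L + 1).factorial := fun j hj => by
    rw [Finset.mem_Ico] at hj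
    exact (Nat.factorial_lt (by omega)).2 hj.2
  have hinj : Set.InjOn (fun j : ℕ => (L + 1).factorial - j.factorial) (Finset.Ico 3 (L + 1)) := by
    intro j hj l hl h
    have h1 := hlt j hj
    have h2 := hlt l hl
    simp only at h
    have h3 : j.factorial = l.factorial := by omega
    rw [Finset.mem_coe, Finset.mem_Ico] at hj
    exact (Nat.factorial_inj (by omega)).1 h3
  have hsub : (Finset.Ico 3 (L + 1)).image (fun j : ℕ => (L + 1).factorial - j.factorial) ⊆
      (Finset.range (L + 1).factorial).filter IsRepeatPos := by
    intro k hk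
    obtain ⟨j, hj, rfl⟩ := Finset.mem_image.1 hk
    have h1 := hlt j hj
    rw [Finset.mem_Ico] at hj
    have h2 := j.factorial_pos
    exact Finset.mem_filter.2 ⟨Finset.mem_range.2 (by omega), L, hL,
      Or.inr ⟨j, hj.1, by omega, by omega⟩⟩
  refine le_trans (le_of_eq ?_) (Finset.sum_le_sum_of_subset_of_nonneg hsub
    fun _ _ _ => by positivity)
  rw [Finset.sum_image hinj]
  refine Finset.sum_congr rfl fun j hj => ?_
  have h1 := hlt j hj
  congr 1
  omega

theorem repeatSum_factorial_le {L : ℕ} (hL : 2 ≤ L) :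
    repeatSum (L + 1).factorial ≤ factorialSum (L + 1) + 2 * (1 / 2) ^ ((L + 1).factorial / 2) := by
  classical
  have hlt : L.factorial + 1 ≤ (L + 1).factorial := (Nat.factorial_lt (by omega)).2 (by omega)
  have hsub : (Finset.range (L + 1).factorial).filter IsRepeatPos ⊆
      (Finset.Ico 3 (L + 1)).image (fun j : ℕ => (L + 1).factorial - j.factorial) ∪
        Finset.range (L.factorial + 1) := by
    intro k hk
    obtain ⟨hk, hk'⟩ := Finset.mem_filter.1 hk
    rcases hk'.cases_of_lt (Finset.mem_range.1 hk) with h | ⟨j, hj, hjL, h⟩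
    · exact Finset.mem_union_right _ (Finset.mem_range.2 (by omega))
    · exact Finset.mem_union_left _ (Finset.mem_image.2
        ⟨j, Finset.mem_Ico.2 ⟨hj, by omega⟩, by omega⟩)
  have himg : ∑ k ∈ (Finset.Ico 3 (L + 1)).image (fun j : ℕ => (L + 1).factorial - j.factorial),
      ((1 : ℝ) / 2) ^ ((L + 1).factorial - k) ≤ factorialSum (L + 1) := by
    refine (Finset.sum_image_le_of_nonneg fun _ _ => by positivity).trans (le_of_eq ?_)
    refine Finset.sum_congr rfl fun j hj => ?_
    rw [Finset.mem_Ico] at hj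
    have := Nat.factorial_le hj.2.le
    congr 1
    omega
  have htail := sum_half_pow_le hlt
  -- Repeats up to L! lie at least half of (L+1)! away, so even the full geometric series over those
  -- positions is negligible.
  have hpow : ((1 : ℝ) / 2) ^ ((L + 1).factorial - (L.factorial + 1)) ≤
      2 * (1 / 2) ^ ((L + 1).factorial / 2) := by
    have h1 : (L + 1).factorial / 2 ≤ (L + 1).factorial - (L.factorial + 1) + 1 := by
      have h2 : 2 * L.factorial ≤ L * L.factorial := Nat.mul_le_mul_right _ hL
      rw [Nat.factorial_succ, add_mul, one_mul]
      omega
    have h2 := pow_le_pow_of_le_one (by norm_num : (0 : ℝ) ≤ 1 / 2) (by norm_num) h1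
    rw [pow_succ] at h2
    linarith
  rw [repeatSum, ← Finset.sum_filter]
  refine (Finset.sum_le_sum_of_subset_of_nonneg hsub fun _ _ _ => by positivity).trans ?_
  have hunion := Finset.sum_union_inter
    (s₁ := (Finset.Ico 3 (L + 1)).image (fun j : ℕ => (L + 1).factorial - j.factorial))
    (s₂ := Finset.range (L.factorial + 1))
    (f := fun k => ((1 : ℝ) / 2) ^ ((L + 1).factorial - k))
  have hinter : 0 ≤ ∑ k ∈ (Finset.Ico 3 (L + 1)).image
      (fun j : ℕ => (L + 1).factorial - j.factorial) ∩ Finset.range (L.factorial + 1),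
      ((1 : ℝ) / 2) ^ ((L + 1).factorial - k) := Finset.sum_nonneg fun _ _ => by positivity
  linarith

/-- All earlier repeats are at distance at least 12. The resulting bound is no larger than the first
term 2^(-3!) of the limit, so these positions do not compete with the factorials. -/
theorem repeatSum_le_of_add_eq {i j L : ℕ} (hj : 3 ≤ j) (hjL : j ≤ L)
    (hi : i + j.factorial = (L + 1).factorial) : repeatSum i ≤ (1 / 2) ^ 6 := by
  classical
  have h12 : ∀ k ∈ (Finset.range i).filter IsRepeatPos, k ∈ Finset.range (i - 11) := by
    intro k hk
    obtain ⟨hk, hk'⟩ := Finset.mem_filter.1 hk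
    have := hk'.add_twelve_le hj hjL hi (Finset.mem_range.1 hk)
    exact Finset.mem_range.2 (by omega)
  have hi6 : 11 ≤ i := by
    have h1 := Nat.factorial_le hjL
    have h2 := six_le_factorial (hj.trans hjL)
    rw [Nat.factorial_succ] at hi
    nlinarith
  rw [repeatSum, ← Finset.sum_filter]
  refine (Finset.sum_le_sum_of_subset_of_nonneg h12 fun _ _ _ => by positivity).trans ?_
  refine (sum_half_pow_le (Nat.sub_le _ _)).trans ?_
  exact pow_le_pow_of_le_one (by norm_num) (by norm_num) (by omega)

/-- The limit of the sums of `2 ^ (-j!)`. -/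
noncomputable def factorialLimit : ℝ := liouvilleNumber 2 - 5 / 4

theorem summable_liouville_two : Summable fun i : ℕ => (1 : ℝ) / 2 ^ i.factorial :=
  LiouvilleNumber.summable (by norm_num)

theorem factorialSum_eq {K : ℕ} (hK : 3 ≤ K) :
    factorialSum K = ∑ i ∈ Finset.range K, (1 : ℝ) / 2 ^ i.factorial - 5 / 4 := by
  rw [factorialSum, ← Finset.sum_range_add_sum_Ico _ hK]
  simp only [one_div_pow]
  norm_num [Finset.sum_range_succ, Nat.factorial]

theorem tendsto_factorialSum : Tendsto factorialSum atTop (𝓝 factorialLimit) := by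
  refine (summable_liouville_two.hasSum.tendsto_sum_nat.sub_const (5 / 4)).congr' ?_
  filter_upwards [eventually_ge_atTop 3] with K hK
  exact (factorialSum_eq hK).symm

theorem factorialSum_le_limit {K : ℕ} (hK : 3 ≤ K) : factorialSum K ≤ factorialLimit := by
  rw [factorialSum_eq hK]
  exact sub_le_sub_right (summable_liouville_two.sum_le_tsum _ fun _ _ => by positivity) _

theorem half_pow_six_le_factorialLimit : ((1 : ℝ) / 2) ^ 6 ≤ factorialLimit := by
  refine le_trans (le_of_eq ?_) (factorialSum_le_limit (show 3 ≤ 4 by norm_num))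
  simp [factorialSum, Nat.factorial]

theorem repeatSum_le {i : ℕ} (hi : IsRepeatPos i) :
    repeatSum i ≤ factorialLimit + 2 * (1 / 2) ^ (i / 2) := by
  obtain ⟨L, hL, rfl | ⟨j, hj, hjL, hi⟩⟩ := hi
  · exact (repeatSum_factorial_le hL).trans
      (add_le_add_left (factorialSum_le_limit (by omega)) _)
  · refine (repeatSum_le_of_add_eq hj hjL hi).trans (half_pow_six_le_factorialLimit.trans ?_)
    exact le_add_of_nonneg_right (by positivity)

theorem transcendental_affine_factorialLimit :
    Transcendental ℚ (7 / 16 - 1 / 8 * factorialLimit) := by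
  intro h
  refine transcendental_liouvilleNumber (m := 2) le_rfl ?_
  have h8 : IsAlgebraic ℚ (8 : ℝ) := by simpa using isAlgebraic_algebraMap (R := ℚ) (A := ℝ) 8
  have h1 : IsAlgebraic ℚ (19 / 4 : ℝ) := by
    simpa using isAlgebraic_algebraMap (R := ℚ) (A := ℝ) (19 / 4)
  have h2 : IsAlgebraic ℚ (liouvilleNumber (2 : ℕ)) := by
    -- The constant is 19/4 = 5/4 + 8 · 7/16, where 5/4 is the sum of the Liouville terms with
    -- exponents 0!, 1!, 2!.
    have heq : (liouvilleNumber (2 : ℕ) : ℝ) =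
        19 / 4 - 8 * (7 / 16 - 1 / 8 * factorialLimit) := by
      rw [factorialLimit, Nat.cast_ofNat]
      ring
    rw [heq]
    exact h1.sub (h8.mul h)
  exact (IsFractionRing.isAlgebraic_iff ℤ ℚ ℝ).2 h2

end FactorialWord

/-! ### The dimension of the group of the factorial word -/

section Dimension
open Filter Topology

theorem factorialLimit_nonneg : 0 ≤ factorialLimit :=
  le_trans (by positivity) half_pow_six_le_factorialLimit

theorem density_factorialWord {p : ℕ} (h : IsRepeatPos (p + 2)) :
    density (4 + p) factorialWord = 7 / 16 + 1 / 2 ^ (p + 4) - 1 / 8 * repeatSum (p + 2) := by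
  have h0 : ¬ IsRepeatPos p := fun h' => by have := h'.add_six_le h (by omega); omega
  have h1 : ¬ IsRepeatPos (p + 1) := fun h' => by have := h'.add_six_le h (by omega); omega
  rw [density_of_eq factorialWord_noCube ((factorialWord_eq_iff _).2 h)
    (fun hp => h0 ((factorialWord_eq_iff _).1 hp)), repeatSum, Finset.sum_range_succ,
    Finset.sum_range_succ, if_neg h0, if_neg h1, add_zero, add_zero]
  congr 2
  classical
  exact Finset.sum_congr rfl fun k _ => if_congr (factorialWord_eq_iff k) rfl rfl

/-- Either the visible word ends in a repeat and the bound on the repeat sum applies, or it does not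
and the density is at least 1/2, already above 7/16. -/
theorem le_density_factorialWord (p : ℕ) :
    7 / 16 - 1 / 8 * (factorialLimit + 2 * (1 / 2) ^ ((p + 2) / 2)) ≤
      density (4 + p) factorialWord := by
  by_cases h : IsRepeatPos (p + 2)
  · rw [density_factorialWord h]
    have := repeatSum_le h
    have h2 : (0 : ℝ) < 1 / 2 ^ (p + 4) := by positivity
    linarith
  · refine le_trans ?_ (half_le_density (by omega) factorialWord_noCube fun hc => h ?_)
    · have := factorialLimit_nonneg
      have h2 : (0 : ℝ) < (1 / 2) ^ ((p + 2) / 2) := by positivity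
      linarith
    · refine (factorialWord_eq_iff _).1 ?_
      rw [show 4 + p - 1 = p + 2 + 1 by omega, show 4 + p - 2 = p + 2 by omega] at hc
      exact hc.symm

theorem dimRatio_eq (c : ℕ → Bool) (n : ℕ) :
    Real.log (cardMod (spinalGroup (letterSeq c)) (n + 1)) / Real.log (cardMod ⊤ (n + 1)) =
      density n c / (1 - (1 / 2) ^ (n + 1)) := by
  have h1 : ((2 ^ (n + 1) - 1 : ℕ) : ℝ) = 2 ^ (n + 1) * (1 - (1 / 2) ^ (n + 1)) := by
    rw [Nat.cast_sub Nat.one_le_two_pow, one_div, inv_pow, mul_sub, mul_one,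
      mul_inv_cancel₀ (by positivity)]
    push_cast
    ring
  rw [log_cardMod_top, cardMod_spinalGroup c (n + 1) false, density, logCard, Real.logb, h1,
    div_div, div_div]
  congr 1
  ring

theorem one_sub_half_pow_pos (n : ℕ) : (0 : ℝ) < 1 - (1 / 2) ^ (n + 1) :=
  sub_pos.2 (pow_lt_one₀ (by norm_num) (by norm_num) (by omega))

theorem density_nonneg (n : ℕ) (c : ℕ → Bool) : 0 ≤ density n c :=
  div_nonneg (div_nonneg (Real.log_natCast_nonneg _) (Real.log_nonneg (by norm_num)))
    (by positivity)

theorem density_le_dimRatio (c : ℕ → Bool) (n : ℕ) : density n c ≤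
    Real.log (cardMod (spinalGroup (letterSeq c)) (n + 1)) / Real.log (cardMod ⊤ (n + 1)) := by
  rw [dimRatio_eq, le_div_iff₀ (one_sub_half_pow_pos n)]
  exact mul_le_of_le_one_right (density_nonneg n c) (sub_le_self _ (by positivity))

theorem le_liminfDim_factorialWord :
    7 / 16 - 1 / 8 * factorialLimit ≤ liminfDim (spinalGroup (letterSeq factorialWord)) := by
  have hlim : Tendsto (fun p : ℕ => 7 / 16 - 1 / 8 *
      (factorialLimit + 2 * ((1 : ℝ) / 2) ^ ((p + 2) / 2))) atTop
      (𝓝 (7 / 16 - 1 / 8 * (factorialLimit + 2 * 0))) := by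
    have h1 : Tendsto (fun p : ℕ => (p + 2) / 2) atTop atTop :=
      tendsto_atTop_mono (fun p => Nat.div_le_div_right (Nat.le_add_right p 2))
        (Nat.tendsto_div_const_atTop two_ne_zero)
    have h2 := (tendsto_pow_atTop_nhds_zero_of_lt_one (r := (1 : ℝ) / 2) (by norm_num)
      (by norm_num)).comp h1
    exact ((h2.const_mul 2).const_add factorialLimit |>.const_mul (1 / 8)).const_sub (7 / 16)
  rw [mul_zero, add_zero] at hlim
  refine le_of_forall_lt fun b hb => ?_
  obtain ⟨b', hb', hb''⟩ := exists_between hb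
  refine hb'.trans_le (le_liminf_of_le (isCoboundedUnder_dimRatio _) ?_)
  obtain ⟨N, hN⟩ := eventually_atTop.1 (hlim.eventually_const_lt hb'')
  filter_upwards [eventually_ge_atTop (N + 5)] with m hm
  obtain ⟨p, rfl⟩ : ∃ p, m = 4 + p + 1 := ⟨m - 5, by omega⟩
  exact (hN p (by omega)).le.trans
    ((le_density_factorialWord p).trans (density_le_dimRatio factorialWord (4 + p)))

theorem liminfDim_factorialWord_le :
    liminfDim (spinalGroup (letterSeq factorialWord)) ≤ 7 / 16 - 1 / 8 * factorialLimit := by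
  -- On K! + 3 levels, with K = L+1, the last visible letters are those at K! and K! + 1, so the
  -- visible word ends exactly in the repeat at K!.
  let φ : ℕ → ℕ := fun L => (L + 1).factorial + 3
  have hφ : Tendsto φ atTop atTop := tendsto_atTop_mono
    (fun L => (Nat.le_succ L).trans ((Nat.self_le_factorial (L + 1)).trans (Nat.le_add_right _ 3)))
    tendsto_id
  have hpow : Tendsto (fun L => ((1 : ℝ) / 2) ^ φ L) atTop (𝓝 0) :=
    (tendsto_pow_atTop_nhds_zero_of_lt_one (by norm_num) (by norm_num)).comp hφ
  have hlim : Tendsto (fun L => (7 / 16 + 2 * ((1 : ℝ) / 2) ^ φ L -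
      1 / 8 * factorialSum (L + 1)) / (1 - (1 / 2) ^ φ L)) atTop
      (𝓝 ((7 / 16 + 2 * 0 - 1 / 8 * factorialLimit) / (1 - 0))) :=
    (((hpow.const_mul 2).const_add _).sub
      ((tendsto_factorialSum.comp (tendsto_add_atTop_nat 1)).const_mul _)).div
      (hpow.const_sub 1) (by norm_num)
  rw [mul_zero, add_zero, sub_zero, div_one] at hlim
  refine le_of_forall_gt_imp_ge_of_dense fun b hb => ?_
  refine liminf_le_of_frequently_le ?_ (isBoundedUnder_dimRatio _)
  refine hφ.frequently (Eventually.frequently ?_)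
  filter_upwards [hlim.eventually_lt_const hb, eventually_ge_atTop 2] with L hL hL2
  refine le_trans ?_ hL.le
  obtain ⟨p, hp⟩ : ∃ p, (L + 1).factorial = p + 2 :=
    ⟨(L + 1).factorial - 2, by have := six_le_factorial (show 3 ≤ L + 1 by omega); omega⟩
  have hφp : φ L = 4 + p + 1 := by
    change (L + 1).factorial + 3 = _
    omega
  have hrep : IsRepeatPos (p + 2) := ⟨L, hL2, Or.inl hp.symm⟩
  have hsum := factorialSum_le_repeatSum hL2
  rw [hp] at hsum
  rw [hφp, dimRatio_eq, density_factorialWord hrep]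
  refine div_le_div_of_nonneg_right ?_ (one_sub_half_pow_pos _).le
  have h1 : (2 : ℝ) * (1 / 2) ^ (4 + p + 1) = 1 / 2 ^ (p + 4) := by
    rw [pow_succ, one_div_pow, add_comm 4 p]
    ring
  rw [h1]
  linarith

theorem liminfDim_factorialWord :
    liminfDim (spinalGroup (letterSeq factorialWord)) = 7 / 16 - 1 / 8 * factorialLimit :=
  le_antisymm liminfDim_factorialWord_le le_liminfDim_factorialWord

end Dimension

theorem corollary5p2 :
    ∃ ω : DualSeq 2, (∀ k, ω k ≠ 0) ∧ diminf ω = 2 ∧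
      (∃ S : Finset AutT, S.card = 3 ∧ Subgroup.closure (S : Set AutT) = spinalGroup ω) ∧
      Transcendental ℚ (hausdorffDim (spinalGroup ω)).toReal ∧
      liminfDim (spinalGroup ω) = (hausdorffDim (spinalGroup ω)).toReal := by
  refine ⟨letterSeq factorialWord, letterSeq_ne_zero _, diminf_letterSeq fun k x => ?_,
    exists_three_generators (i := 0) rfl, ?_, (hausdorffDim_toReal _).symm⟩
  · obtain ⟨i, -, hi⟩ := factorialWord_noCube.exists_eq k x
    exact ⟨i, by rwa [add_comm]⟩
  · rw [hausdorffDim_toReal, liminfDim_factorialWord]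
    exact transcendental_affine_factorialLimit
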